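/- **Setting.** Let $1\le k\le d<n$ be integers and let $\mathbb F$ be a finite field. An $(n,k,d)$ *exact-repair regenerating code* with parameters $(\alpha,\beta,F)$ encodes a file of $F$ symbols of $\mathbb F$ into $n$ nodes, each storing $\alpha$ symbols of $\mathbb F$, such that (data recovery) the file can be recovered from the contents of any $k$ nodes, and (exact repair) the content of any node $f$ can be regenerated from any $d$ other nodes, each of which sends $\beta$ symbols computed from its own content. The cut-set bound for real $(\alpha,\beta,F)$ is $$F\le\sum_{i=1}^k\min\bigl(\alpha,(d-i+1)\beta\bigr).\qquad(*)$$ The code is an *MBR code* if, for its $F$, $(\alpha,\beta)$ satisfies $(*)$, $\beta$ is the smallest real number for which some $(\alpha',\beta)$ satisfies $(*)$, and $\alpha$ is the smallest real number for this $\beta$. It is an *MSR code* if $(\alpha,\beta)$ satisfies $(*)$, $\alpha$ is the smallest real number for which some $(\alpha,\beta')$ satisfies $(*)$, and $\beta$ is the smallest real number for this $\alpha$. **Cascade codes.** Write $[d]=\{1,\dots,d\}$, $[k+1:d]=\{k+1,\dots,d\}$ and $\mathrm{ind}_I(x)=|\{y\in I:y\le x\}|$, and put $\max\varnothing=-\infty$.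 Let $\Psi=(\psi_{i,x})$ be an $n\times d$ matrix over $\mathbb F$, any $d$ rows of which are linearly independent, and such that any $k$ rows of the matrix formed by its first $k$ columns are linearly independent. Let $\mu\in\{1,\dots,k\}$. The *segments* of the code of mode $\mu$ form a rooted tree; each segment $P$ has a mode $m_P\ge 0$ and a signature $\sigma_P:[d]\to\mathbb Z$. The root has mode $\mu$ and signature $0$. A segment $P$ has one child $Q$ for each pair $(x,B)$ with $B\subseteq[k+1:d]$, $|B|<m_P$, $x\in[k+1:d]$ and $x\le\max B$; then $m_Q=m_P-|B|-1$ and $\sigma_Q(i)=1+\sigma_P(i)+\mathrm{ind}_{B\cup\{i\}}(i)$. Every segment $P$, with $m=m_P$, has its own symbols $v_{x,X}$ ($X\subseteq[d]$, $|X|=m$, $x\in X$) and $w_{x,Y}$ ($Y\subseteq[d]$, $|Y|=m+1$, $x\in Y$). Those $v_{x,X}$ with $X\subseteq[k+1:d]$, and those $w_{x,Y}$ with $x\ne\max Y$ and $Y\subseteq[k+1:d]$, are set to zero. The other $v_{x,X}$, and the other $w_{x,Y}$ with $x\neq\max Y$, over all segments, are the free data symbols that form the file. The symbols $w_{\max Y,Y}$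 are determined by $\sum_{y\in Y}(-1)^{\mathrm{ind}_Y(y)}w_{y,Y}=0$. For $x\in[d]$ and $I\subseteq[d]$ with $|I|=m$, let $P_{x,I}=(-1)^{\sigma_P(x)}v_{x,I}$ if $x\in I$ and $P_{x,I}=(-1)^{\sigma_P(x)}w_{x,I\cup\{x\}}$ if $x\notin I$. The modified matrix of the root is the root's own matrix. The modified matrix of the child $Q$ of $P$ for the pair $(x,B)$ is $Q+\Delta$, where $$\Delta_{i,I}=(-1)^{1+\sigma_P(i)+\mathrm{ind}_{I\cup\{i\}\cup B}(i)}P_{x,I\cup\{i\}\cup B}\quad\text{if } i>\max I,\ i\notin B,\ I\cap B=\varnothing,$$ and $\Delta_{i,I}=0$ otherwise. The super message matrix $M$ is the concatenation of the modified matrices of all segments. In the *cascade code of mode $\mu$*, node $i$ stores the $i$-th row of $\Psi M$. To repair a node $f$, a helper $h$ multiplies, for every segment $P$ with $m_P\geq 1$, its codeword segment (the part of its content that belongs to $P$) by the matrix $\Xi^{f,P}$ whose rows $I$ and columns $J$ are the subsets of $[d]$ of size $m_P$ and $m_P-1$, and whose entry at $(I,J)$ is $(-1)^{\sigma_P(y)+\mathrm{ind}_I(y)}\psi_{f,y}$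 if $I\setminus J=\{y\}$ and $0$ otherwise. The result is the *repair data* that $h$ sends; it is a linear function of the content of $h$ that does not depend on the other helpers. **Claim.** The cascade code of mode $\mu=1$ is an MBR code with parameters $$(\alpha,\beta,F)=\Bigl(d,\;1,\;\tfrac{k(2d-k+1)}2\Bigr),$$ and the cascade code of mode $\mu=k$ is an MSR code with parameters $$(\alpha,\beta,F)=\bigl((d-k+1)^k,\;(d-k+1)^{k-1},\;k(d-k+1)^k\bigr).$$ In both cases the stated $\beta$ is attained by the repair mechanism above: for every node $f$, the linear map from the content of a helper (in $\mathbb F^\alpha$) to its repair data has rank exactly $\beta$, and the repair data of any $d$ nodes other than $f$ determine the content of $f$. -/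

import Mathlib

/-! ### Regenerating codes and the cut-set bound -/

/-- A distributed storage code over the alphabet `𝔽`: a file, which assigns an element of `𝔽` to
each symbol index in `σ`, is encoded into `n` node contents; the content of a node assigns an
element of `𝔽` to each index in `ι`. -/
abbrev StorageCode (𝔽 σ ι : Type*) (n : ℕ) := (σ → 𝔽) → Fin n → ι → 𝔽

/-- `C` is an `(n, k, d)` exact-repair regenerating code with per-node storage `α`, per-node repair
bandwidth `β` and file size `F`. -/
structure IsExactRepairRegeneratingCode {𝔽 σ ι : Type*} {n : ℕ} (k d α β F : ℕ)
    (C : StorageCode 𝔽 σ ι n) : Prop where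
  /-- Every node stores `α` symbols. -/
  storage : Finite ι ∧ Nat.card ι = α
  /-- The file consists of `F` symbols. -/
  fileSize : Finite σ ∧ Nat.card σ = F
  /-- Data recovery: the file can be recovered from the content of any `k` nodes. -/
  recovery : ∀ K : Finset (Fin n), K.card = k →
    ∃ decode : (K → ι → 𝔽) → (σ → 𝔽), ∀ s, decode (fun i => C s i) = s
  /-- Exact node repair: the content of a failed node `f` can be regenerated from any `d` other
  nodes, each of which sends `β` symbols that are computed from its own content. -/
  repair : ∀ (f : Fin n) (H : Finset (Fin n)), f ∉ H → H.card = d →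
    ∃ (send : H → (ι → 𝔽) → (Fin β → 𝔽)) (regenerate : (H → Fin β → 𝔽) → (ι → 𝔽)),
      ∀ s, regenerate (fun h => send h (C s h)) = C s f

/-- The cut-set bound `F ≤ ∑_{i=1}^k min(α, (d-i+1)β)`. -/
def CutSetBound (k d : ℕ) (α β F : ℝ) : Prop :=
  F ≤ ∑ i ∈ Finset.Icc 1 k, min α (((d : ℝ) - (i : ℝ) + 1) * β)

/-- The minimum bandwidth regeneration point for file size `F`: `β` is the least repair bandwidth
that is compatible with the cut-set bound, and `α` is the least storage for that `β`. -/
def IsMBRPoint (k d : ℕ) (α β F : ℝ) : Prop :=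
  CutSetBound k d α β F ∧
    ∀ α' β' : ℝ, CutSetBound k d α' β' F → β ≤ β' ∧ (β' = β → α ≤ α')

/-- The minimum storage regeneration point for file size `F`: `α` is the least storage that is
compatible with the cut-set bound, and `β` is the least repair bandwidth for that `α`. -/
def IsMSRPoint (k d : ℕ) (α β F : ℝ) : Prop :=
  CutSetBound k d α β F ∧
    ∀ α' β' : ℝ, CutSetBound k d α' β' F → α ≤ α' ∧ (α' = α → β ≤ β')

/-- An MBR code with parameters `(α, β, F)`. -/
def IsMBRCode {𝔽 σ ι : Type*} {n : ℕ} (k d α β F : ℕ) (C : StorageCode 𝔽 σ ι n) : Prop :=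
  IsExactRepairRegeneratingCode k d α β F C ∧ IsMBRPoint k d α β F

/-- An MSR code with parameters `(α, β, F)`. -/
def IsMSRCode {𝔽 σ ι : Type*} {n : ℕ} (k d α β F : ℕ) (C : StorageCode 𝔽 σ ι n) : Prop :=
  IsExactRepairRegeneratingCode k d α β F C ∧ IsMSRPoint k d α β F

/-- The linear maps `R f` form a repair mechanism of bandwidth `β`: to repair `f`, each helper `h`
sends (the information in) `R f` applied to its own content, regardless of who the other helpers
are; this amounts to `β = rank (R f)` symbols, and `d` helpers suffice to regenerate `f`. -/
def IsRepairMechanism {𝔽 σ ι ρ : Type*} [Field 𝔽] {n : ℕ} (d β : ℕ) (C : StorageCode 𝔽 σ ι n)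
    (R : Fin n → (ι → 𝔽) →ₗ[𝔽] (ρ → 𝔽)) : Prop :=
  ∀ f : Fin n, Module.finrank 𝔽 (LinearMap.range (R f)) = β ∧
    ∀ H : Finset (Fin n), f ∉ H → H.card = d →
      ∃ regenerate : (H → ρ → 𝔽) → (ι → 𝔽),
        ∀ s, regenerate (fun h => R f (C s h)) = C s f

/-! ### Cascade codes

The integers `1, …, d` of the construction are represented by `Fin d`, so that `[1:k]` consists of
the `x : Fin d` with `x.val < k`, and `[k+1:d]` of those with `k ≤ x.val`. -/

namespace Cascade

/-- Encoder matrices `Ψ = [Γ | Υ]`: any `k` rows of `Γ` (the first `k` columns) are linearly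
independent, and any `d` rows of `Ψ` are linearly independent. -/
structure IsEncoder {𝔽 : Type*} [Field 𝔽] {n d : ℕ} (k : ℕ) (Ψ : Matrix (Fin n) (Fin d) 𝔽) :
    Prop where
  gamma : ∀ K : Finset (Fin n), K.card = k →
    LinearIndependent 𝔽 (fun (i : K) (j : {j : Fin d // j.val < k}) => Ψ i j)
  psi : ∀ H : Finset (Fin n), H.card = d →
    LinearIndependent 𝔽 (fun (i : H) (j : Fin d) => Ψ i j)

/-- `ind I x` is the number of elements of `I` that do not exceed `x`. -/
def ind {d : ℕ} (I : Finset (Fin d)) (x : Fin d) : ℕ := (I.filter (fun y => y ≤ x)).card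

/-- Labels of code segments: the root, and the child of `P` for the injection pair `(x, B)`. -/
inductive Segment (d : ℕ) : Type
  | root : Segment d
  | child (P : Segment d) (x : Fin d) (B : Finset (Fin d)) : Segment d

/-- The mode of a code segment. -/
def mode {d : ℕ} (μ : ℕ) : Segment d → ℕ
  | .root => μ
  | .child P _ B => mode μ P - B.card - 1

/-- The labels that do occur in the cascade code of mode `μ`: `(x, B)` is an injection pair of `P`
if `B ⊆ [k+1:d]`, `|B| < mode P`, `x ∈ [k+1:d]` and `x ≤ max B`. -/
def IsSegment {d : ℕ} (k μ : ℕ) : Segment d → Prop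
  | .root => True
  | .child P x B => IsSegment k μ P ∧ (∀ b ∈ B, k ≤ b.val) ∧ B.card < mode μ P ∧
      k ≤ x.val ∧ ∃ b ∈ B, x ≤ b

/-- The signature of a code segment. -/
def signature {d : ℕ} : Segment d → Fin d → ℕ
  | .root, _ => 0
  | .child P _ B, i => 1 + signature P i + ind (B ∪ {i}) i

/-- The positions (row `x`, column `J`) whose symbols are set to zero: those in the lower `d - k`
rows with `x ≤ max J` and `J ∩ [1:k] = ∅`. -/
def IsNulled {d : ℕ} (k : ℕ) (x : Fin d) (J : Finset (Fin d)) : Prop :=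
  k ≤ x.val ∧ (∃ j ∈ J, x ≤ j) ∧ ∀ j ∈ J, k ≤ j.val

/-- The raw symbols `v_{x,X}` of the code segments, without the nulled ones. -/
def VSymbol (k d μ : ℕ) : Type :=
  {p : Segment d × Fin d × Finset (Fin d) //
    IsSegment k μ p.1 ∧ p.2.2.card = mode μ p.1 ∧ p.2.1 ∈ p.2.2 ∧ ¬ IsNulled k p.2.1 p.2.2}

/-- The raw symbols `w_{x,Y}`, `x ≠ max Y`, of the code segments, without the nulled ones. The
position of `w_{x,Y}` is in row `x` and column `Y \ {x}`. -/
def WSymbol (k d μ : ℕ) : Type :=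
  {p : Segment d × Fin d × Finset (Fin d) //
    IsSegment k μ p.1 ∧ p.2.2.card = mode μ p.1 + 1 ∧ p.2.1 ∈ p.2.2 ∧ (∃ y ∈ p.2.2, p.2.1 < y) ∧
      ¬ IsNulled k p.2.1 (p.2.2.erase p.2.1)}

/-- The indices of the data symbols that are stored in the super message matrix. -/
abbrev FileSymbol (k d μ : ℕ) : Type := VSymbol k d μ ⊕ WSymbol k d μ

section Message

variable {𝔽 : Type*} [Field 𝔽] {k d μ : ℕ}

open Classical in
/-- The symbol `v_{x,X}` of the segment `P` (zero if it is nulled). -/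
noncomputable def vSym (s : FileSymbol k d μ → 𝔽) (P : Segment d) (x : Fin d)
    (X : Finset (Fin d)) : 𝔽 :=
  if h : IsSegment k μ P ∧ X.card = mode μ P ∧ x ∈ X ∧ ¬ IsNulled k x X
  then s (Sum.inl ⟨(P, x, X), h⟩) else 0

open Classical in
/-- The symbol `w_{x,Y}` of the segment `P` for `x ≠ max Y` (zero if it is nulled). -/
noncomputable def wRaw (s : FileSymbol k d μ → 𝔽) (P : Segment d) (x : Fin d)
    (Y : Finset (Fin d)) : 𝔽 :=
  if h : IsSegment k μ P ∧ Y.card = mode μ P + 1 ∧ x ∈ Y ∧ (∃ y ∈ Y, x < y) ∧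
      ¬ IsNulled k x (Y.erase x)
  then s (Sum.inr ⟨(P, x, Y), h⟩) else 0

/-- The symbol `w_{x,Y}` of the segment `P`, `x ∈ Y`. For `x = max Y` it is the parity symbol, which
is determined by the parity equation of `Y`. -/
noncomputable def wSym (s : FileSymbol k d μ → 𝔽) (P : Segment d) (x : Fin d)
    (Y : Finset (Fin d)) : 𝔽 :=
  if ∀ y ∈ Y, y ≤ x then
    -((-1) ^ ind Y x * ∑ y ∈ Y.erase x, (-1) ^ ind Y y * wRaw s P y Y)
  else wRaw s P x Y

/-- The parity equation. -/
theorem parity_equation (s : FileSymbol k d μ → 𝔽) (P : Segment d) (Y : Finset (Fin d)) :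
    ∑ y ∈ Y, (-1) ^ ind Y y * wSym s P y Y = 0 := by
  rcases Y.eq_empty_or_nonempty with rfl | hY
  · simp
  · have hm : Y.max' hY ∈ Y := Y.max'_mem hY
    have hmax : ∀ y ∈ Y, y ≤ Y.max' hY := fun y hy => Y.le_max' y hy
    have hrest : ∑ y ∈ Y.erase (Y.max' hY), (-1) ^ ind Y y * wSym s P y Y
        = ∑ y ∈ Y.erase (Y.max' hY), (-1) ^ ind Y y * wRaw s P y Y := by
      refine Finset.sum_congr rfl fun y hy => ?_
      have hne : ¬ ∀ z ∈ Y, z ≤ y := fun h =>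
        (Finset.ne_of_mem_erase hy) (le_antisymm (hmax y (Finset.mem_of_mem_erase hy)) (h _ hm))
      rw [wSym, if_neg hne]
    have hsq : ((-1 : 𝔽) ^ ind Y (Y.max' hY)) * (-1) ^ ind Y (Y.max' hY) = 1 := by
      rw [← mul_pow]; simp
    rw [← Finset.add_sum_erase Y _ hm, hrest, wSym, if_pos hmax, mul_neg, ← mul_assoc, hsq,
      one_mul, neg_add_cancel]

/-- The message matrix of the signed determinant code of the segment `P`, before injection. Only
the columns `I` with `|I| = mode P` are used. -/
noncomputable def message (s : FileSymbol k d μ → 𝔽) (P : Segment d) (x : Fin d)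
    (I : Finset (Fin d)) : 𝔽 :=
  (-1) ^ signature P x * (if x ∈ I then vSym s P x I else wSym s P x (I ∪ {x}))

/-- The injection matrix into a segment from its parent (zero for the root). -/
noncomputable def injection (s : FileSymbol k d μ → 𝔽) :
    Segment d → Fin d → Finset (Fin d) → 𝔽
  | .root, _, _ => 0
  | .child P x B, i, I =>
      if (∀ j ∈ I, j < i) ∧ i ∉ B ∧ I ∩ B = ∅ then
        (-1) ^ (1 + signature P i + ind (I ∪ {i} ∪ B) i) * message s P x (I ∪ {i} ∪ B)
      else 0

/-- The columns of the super message matrix: a code segment `P` and a set of `mode P` integers. -/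
abbrev Column (k d μ : ℕ) : Type :=
  {c : Segment d × Finset (Fin d) // IsSegment k μ c.1 ∧ c.2.card = mode μ c.1}

/-- The super message matrix: the concatenation of all code segments after injection. -/
noncomputable def superMessage (s : FileSymbol k d μ → 𝔽) : Matrix (Fin d) (Column k d μ) 𝔽 :=
  Matrix.of fun x c => message s c.1.1 x c.1.2 + injection s c.1.1 x c.1.2

end Message

/-- The `(n, k, d; μ)` cascade code with encoder matrix `Ψ`: node `i` stores the `i`-th row of the
product of `Ψ` and the super message matrix. -/
noncomputable def code {𝔽 : Type*} [Field 𝔽] {n d : ℕ} (k μ : ℕ) (Ψ : Matrix (Fin n) (Fin d) 𝔽) :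
    StorageCode 𝔽 (FileSymbol k d μ) (Column k d μ) n :=
  fun s i => (Ψ * superMessage s) i

/-- The repair-encoder matrix of the failed node `f` for the segment `P`: its entry at `(I, J)` is
`(-1)^{σ_P(y) + ind_I(y)} ψ_{f,y}` if `I \ J = {y}`, and zero if `I \ J` is not a singleton. -/
def repairEncoder {𝔽 : Type*} [Field 𝔽] {n d : ℕ} (Ψ : Matrix (Fin n) (Fin d) 𝔽) (f : Fin n)
    (P : Segment d) (I J : Finset (Fin d)) : 𝔽 :=
  ∑ y : Fin d, if I \ J = {y} then (-1) ^ (signature P y + ind I y) * Ψ f y else 0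

/-- The indices of the repair data: a code segment `P` and a set of `mode P - 1` integers. -/
abbrev RepairIndex (k d μ : ℕ) : Type :=
  {c : Segment d × Finset (Fin d) // IsSegment k μ c.1 ∧ c.2.card + 1 = mode μ c.1}

/-- The repair data for the failed node `f`, computed from the content of a helper node: each
codeword segment is multiplied by the repair-encoder matrix of `f`. -/
def repairData {𝔽 : Type*} [Field 𝔽] {n d : ℕ} (k μ : ℕ) (Ψ : Matrix (Fin n) (Fin d) 𝔽)
    (f : Fin n) : (Column k d μ → 𝔽) →ₗ[𝔽] (RepairIndex k d μ → 𝔽) where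
  toFun c := fun r => ∑ I : {I : Finset (Fin d) // I.card = mode μ r.1.1},
    c ⟨(r.1.1, I.1), r.2.1, I.2⟩ * repairEncoder Ψ f r.1.1 I.1 r.1.2
  map_add' a b := by
    funext r
    simp [add_mul, Finset.sum_add_distrib]
  map_smul' a b := by
    funext r
    simp [mul_assoc, Finset.mul_sum]

end Cascade

namespace Cascade

variable {𝔽 : Type*} [Field 𝔽] {k d μ n : ℕ}

/-! ### Signs -/

/-! Encoding is linear, so recovery and repair both reduce to showing that zero observations force
zero data. The link between segments is `sum_modified_child`: injection breaks the parity equation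
of a child `(x, B)` over `Y` exactly by the parent symbol in row `x`, column `Y ∪ B`, when `Y` and
`B` are disjoint. A child therefore protects symbols of its parent.

Data recovery is an induction on the number `u` of elements of a column in `[1:k]`. In that column
the lower `d - k` rows vanish: for `u = 0` by nulling, otherwise because their symbols are parity
sums of children over columns with `u - 1` such elements, or are parity symbols of entries already
treated. The `k` rows of `Γ` then kill the upper rows.

Repair rests on an antisymmetry of Koszul type. By `sum_repair_identity`, an entry of the failed
node is a signed sum of repair-space entries of the same segment plus `ψ_f`-weighted parity sums.
The latter vanish at the root, and at a child they add up to a repair-space entry of the parent. Any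
`d` rows of `Ψ` recover the repair space. Consecutive repair encoders compose to zero, so if
`ψ_{f,y₀} ≠ 0` the repair data is free exactly on the columns avoiding `y₀`; this gives the rank.

For the parameters put `r = d - k`. The tree recursion gives the series `1 / ((1 + X)^r (1 - rX))`
for segments by mode deficit. Hence `α` is the coefficient of `X^μ` in `(1 + X)^k / (1 - rX)`, `β`
that of `X^(μ-1)` with `k - 1` for `k`, and `F` is `dα` minus the next coefficient of the first
series. The cases `μ = 1` and `μ = k` have closed forms, which are compared with the cut-set bound.
-/

theorem ind_insert {I : Finset (Fin d)} {y : Fin d} (hy : y ∉ I) (x : Fin d) :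
    ind (insert y I) x = ind I x + if y ≤ x then 1 else 0 := by
  unfold ind
  rw [Finset.filter_insert]
  split_ifs with h
  · rw [Finset.card_insert_of_notMem (by simp [hy])]
  · simp

theorem ind_insert_self {I : Finset (Fin d)} {y : Fin d} (hy : y ∉ I) :
    ind (insert y I) y = ind I y + 1 := by
  simp [ind_insert hy]

theorem ind_union {I J : Finset (Fin d)} (h : Disjoint I J) (x : Fin d) :
    ind (I ∪ J) x = ind I x + ind J x := by
  unfold ind
  rw [Finset.filter_union, Finset.card_union_of_disjoint (Finset.disjoint_filter_filter h)]

theorem neg_one_pow_mul_self (a : ℕ) : (-1 : 𝔽) ^ a * (-1) ^ a = 1 := by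
  rw [← mul_pow]; simp

theorem neg_one_pow_mul_eq_zero {a : ℕ} {x : 𝔽} (h : (-1) ^ a * x = 0) : x = 0 := by
  have := congrArg ((-1 : 𝔽) ^ a * ·) h
  simpa [← mul_assoc, neg_one_pow_mul_self] using this

theorem neg_one_pow_congr {a b : ℕ} (h : Even (a + b)) : (-1 : 𝔽) ^ a = (-1) ^ b := by
  rcases Nat.even_or_odd a with ha | ha
  · rw [ha.neg_one_pow, ((Nat.even_add.1 h).1 ha).neg_one_pow]
  · rw [ha.neg_one_pow, Odd.neg_one_pow]
    rw [← Nat.not_even_iff_odd] at ha ⊢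
    rwa [← Nat.even_add.1 h]

theorem neg_one_pow_eq_neg {a b : ℕ} (h : Odd (a + b)) : (-1 : 𝔽) ^ a = -(-1) ^ b := by
  rw [neg_one_pow_congr (b := b + 1) (by rw [← add_assoc]; exact h.add_one), pow_succ, mul_neg_one]

theorem ind_le_add_ind_le {i y : Fin d} (h : i ≠ y) :
    (if i ≤ y then 1 else 0) + (if y ≤ i then 1 else 0) = 1 := by
  rcases lt_or_gt_of_ne h with h | h
  · simp [h.le, h.not_ge]
  · simp [h.le, h.not_ge]

/-- Exchanging the order in which two elements are removed changes the sign. -/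
theorem neg_one_pow_ind_erase {I : Finset (Fin d)} {i y : Fin d} (hi : i ∈ I) (hy : y ∉ I) :
    (-1 : 𝔽) ^ ind I i * (-1) ^ ind (insert y (I.erase i)) y =
      -((-1) ^ ind (insert y I) y * (-1) ^ ind (insert y I) i) := by
  have hiy : i ≠ y := fun h => hy (h ▸ hi)
  have h1 := ind_insert (I := I.erase i) (y := i) (by simp) y
  have h2 := ind_insert_self (I := I.erase i) (y := y) (by simp [hy])
  rw [Finset.insert_erase hi] at h1
  rw [ind_insert_self hy, ind_insert hy, h1, h2, ← pow_add, ← pow_add]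
  apply neg_one_pow_eq_neg
  have := ind_le_add_ind_le hiy
  refine ⟨ind I i + ind (I.erase i) y + 1, ?_⟩
  omega

theorem neg_one_pow_ind_insert_comm {L : Finset (Fin d)} {y z : Fin d} (hy : y ∉ L) (hz : z ∉ L)
    (hyz : y ≠ z) :
    (-1 : 𝔽) ^ ind (insert y L) y * (-1) ^ ind (insert z (insert y L)) z =
      -((-1) ^ ind (insert z L) z * (-1) ^ ind (insert y (insert z L)) y) := by
  rw [ind_insert_self hy, ind_insert_self hz,
    ind_insert_self (I := insert y L) (y := z) (by simp [hz, hyz.symm]),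
    ind_insert_self (I := insert z L) (y := y) (by simp [hy, hyz]),
    ind_insert hy, ind_insert hz, ← pow_add, ← pow_add]
  apply neg_one_pow_eq_neg
  have := ind_le_add_ind_le hyz
  refine ⟨ind L y + ind L z + 2, ?_⟩
  omega

/-! ### Segments -/

theorem isSegment_child {P : Segment d} {x : Fin d} {B : Finset (Fin d)} :
    IsSegment k μ (.child P x B) ↔ IsSegment k μ P ∧ IsNulled k x B ∧ B.card < mode μ P := by
  simp only [IsSegment, IsNulled]
  tauto

theorem mode_child {P : Segment d} {x : Fin d} {B : Finset (Fin d)}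
    (h : IsSegment k μ (.child P x B)) : mode μ (.child P x B) + B.card + 1 = mode μ P := by
  have := (isSegment_child.1 h).2.2
  simp only [mode]
  omega

/-! ### The modified message matrices -/

/-- The message matrix of the segment `P` after injection. -/
noncomputable def modified (s : FileSymbol k d μ → 𝔽) (P : Segment d) (x : Fin d)
    (I : Finset (Fin d)) : 𝔽 :=
  message s P x I + injection s P x I

theorem injection_eq_zero (s : FileSymbol k d μ → 𝔽) (P : Segment d) {x : Fin d}
    {I : Finset (Fin d)} (h : ∃ j ∈ I, x ≤ j) : injection s P x I = 0 := by
  cases P with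
  | root => rfl
  | child P z B =>
    obtain ⟨j, hj, hxj⟩ := h
    rw [injection, if_neg]
    exact fun h => (h.1 j hj).not_ge hxj

/-- Injection only touches parity positions, those whose row lies above every element of the column.
-/
theorem modified_eq_message (s : FileSymbol k d μ → 𝔽) (P : Segment d) {x : Fin d}
    {I : Finset (Fin d)} (h : ∃ j ∈ I, x ≤ j) : modified s P x I = message s P x I := by
  rw [modified, injection_eq_zero s P h, add_zero]

/-- Off the column, a parity symbol over a set inside `[k+1:d]` is a combination of nulled symbols
only, so it vanishes as well. -/
theorem message_eq_zero_of_low (s : FileSymbol k d μ → 𝔽) (P : Segment d) {x : Fin d}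
    {J : Finset (Fin d)} (hx : k ≤ x.val) (hJ : ∀ j ∈ J, k ≤ j.val) : message s P x J = 0 := by
  rw [message]
  split_ifs with hxJ
  · rw [vSym, dif_neg, mul_zero]
    exact fun h => h.2.2.2 ⟨hx, ⟨x, hxJ, le_rfl⟩, hJ⟩
  · have hJx : ∀ j ∈ J ∪ {x}, k ≤ j.val := by
      intro j hj
      rcases Finset.mem_union.1 hj with h | h
      · exact hJ j h
      · rw [Finset.mem_singleton.1 h]; exact hx
    have key : ∀ y ∈ J ∪ {x}, wRaw s P y (J ∪ {x}) = 0 := by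
      intro y hy
      rw [wRaw, dif_neg]
      rintro ⟨-, -, -, ⟨z, hz, hyz⟩, hn⟩
      exact hn ⟨hJx y hy, ⟨z, Finset.mem_erase.2 ⟨hyz.ne', hz⟩, hyz.le⟩,
        fun j hj => hJx j (Finset.mem_of_mem_erase hj)⟩
    rw [wSym]
    split_ifs
    · rw [Finset.sum_eq_zero, mul_zero, neg_zero, mul_zero]
      intro y hy
      rw [key y (Finset.mem_of_mem_erase hy), mul_zero]
    · rw [key x (by simp), mul_zero]

theorem sum_message_eq_zero (s : FileSymbol k d μ → 𝔽) (P : Segment d) (Y : Finset (Fin d)) :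
    ∑ y ∈ Y, (-1) ^ (signature P y + ind Y y) * message s P y (Y.erase y) = 0 := by
  rw [← parity_equation s P Y]
  refine Finset.sum_congr rfl fun y hy => ?_
  have h : Y.erase y ∪ {y} = Y := by
    rw [Finset.union_comm, ← Finset.insert_eq, Finset.insert_erase hy]
  rw [message, if_neg (Finset.notMem_erase y Y), h, pow_add]
  linear_combination (-1) ^ ind Y y * wSym s P y Y * neg_one_pow_mul_self (𝔽 := 𝔽) (signature P y)

theorem sum_modified_root (s : FileSymbol k d μ → 𝔽) (Y : Finset (Fin d)) :
    ∑ y ∈ Y, (-1) ^ (signature (.root : Segment d) y + ind Y y) *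
      modified s .root y (Y.erase y) = 0 := by
  simpa [modified, injection] using sum_message_eq_zero s .root Y

/-- The parity sums of a segment after injection are, up to sign, the injected symbols. -/
theorem sum_modified_child (s : FileSymbol k d μ → 𝔽) (P : Segment d) (x : Fin d)
    (B : Finset (Fin d)) {Y : Finset (Fin d)} (hY : Y.Nonempty) :
    ∑ y ∈ Y, (-1) ^ (signature (.child P x B) y + ind Y y) *
      modified s (.child P x B) y (Y.erase y) =
      if Disjoint Y B then -message s P x (Y ∪ B) else 0 := by
  have hm : Y.max' hY ∈ Y := Y.max'_mem hY
  set M := Y.max' hY with hM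
  have hlt : ∀ j ∈ Y.erase M, j < M := fun j hj =>
    lt_of_le_of_ne (Y.le_max' j (Finset.mem_of_mem_erase hj)) (Finset.ne_of_mem_erase hj)
  simp only [modified, mul_add, Finset.sum_add_distrib, sum_message_eq_zero, zero_add]
  -- The unmodified parity sum is zero, and among the injected terms only the row `max Y` lies above
  -- its column.
  rw [Finset.sum_eq_single_of_mem M hm]
  · rw [injection]
    have hcond : ((∀ j ∈ Y.erase M, j < M) ∧ M ∉ B ∧ Y.erase M ∩ B = ∅) ↔ Disjoint Y B := by
      rw [← Finset.disjoint_iff_inter_eq_empty]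
      conv_rhs => rw [← Finset.insert_erase hm, Finset.disjoint_insert_left]
      tauto
    by_cases hd : Disjoint Y B
    · rw [if_pos (hcond.2 hd), if_pos hd]
      have hYM : Y.erase M ∪ {M} = Y := by
        rw [Finset.union_comm, ← Finset.insert_eq, Finset.insert_erase hm]
      have hMB : M ∉ B := (hcond.2 hd).2.1
      have hBM : B ∪ {M} = insert M B := by rw [Finset.union_comm, ← Finset.insert_eq]
      rw [hYM, signature, ind_union hd, hBM, ind_insert_self hMB, ← mul_assoc, ← pow_add]
      -- The signature of the child is chosen so that every term of the exponent occurs twice, up to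
      -- an odd constant.
      rw [Odd.neg_one_pow, neg_one_mul]
      exact ⟨signature P M + ind B M + ind Y M + 1, by ring⟩
    · rw [if_neg (fun h => hd (hcond.1 h)), if_neg hd, mul_zero]
  · intro y hy hne
    rw [injection_eq_zero, mul_zero]
    exact ⟨M, Finset.mem_erase.2 ⟨hne.symm, hm⟩, Y.le_max' y hy⟩

/-! ### Linearity -/

theorem vSym_sub (s t : FileSymbol k d μ → 𝔽) (P : Segment d) (x : Fin d) (X : Finset (Fin d)) :
    vSym (s - t) P x X = vSym s P x X - vSym t P x X := by
  unfold vSym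
  split_ifs <;> simp

theorem wRaw_sub (s t : FileSymbol k d μ → 𝔽) (P : Segment d) (x : Fin d) (X : Finset (Fin d)) :
    wRaw (s - t) P x X = wRaw s P x X - wRaw t P x X := by
  unfold wRaw
  split_ifs <;> simp

theorem wSym_sub (s t : FileSymbol k d μ → 𝔽) (P : Segment d) (x : Fin d) (X : Finset (Fin d)) :
    wSym (s - t) P x X = wSym s P x X - wSym t P x X := by
  unfold wSym
  simp only [wRaw_sub, mul_sub, Finset.sum_sub_distrib]
  split_ifs <;> ring

theorem message_sub (s t : FileSymbol k d μ → 𝔽) (P : Segment d) (x : Fin d)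
    (X : Finset (Fin d)) : message (s - t) P x X = message s P x X - message t P x X := by
  unfold message
  rw [vSym_sub, wSym_sub]
  split_ifs <;> ring

theorem injection_sub (s t : FileSymbol k d μ → 𝔽) (P : Segment d) (x : Fin d)
    (X : Finset (Fin d)) : injection (s - t) P x X = injection s P x X - injection t P x X := by
  cases P with
  | root => simp [injection]
  | child P z B =>
    simp only [injection, message_sub]
    split_ifs <;> ring

theorem superMessage_sub (s t : FileSymbol k d μ → 𝔽) :
    superMessage (s - t) = superMessage s - superMessage t := by
  ext x c
  simp only [superMessage, Matrix.of_apply, Matrix.sub_apply, message_sub, injection_sub]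
  ring

theorem code_sub (Ψ : Matrix (Fin n) (Fin d) 𝔽) (s t : FileSymbol k d μ → 𝔽)
    (i : Fin n) : code k μ Ψ (s - t) i = code k μ Ψ s i - code k μ Ψ t i := by
  simp only [code, superMessage_sub, Matrix.mul_sub]
  rfl

theorem code_apply (Ψ : Matrix (Fin n) (Fin d) 𝔽) (s : FileSymbol k d μ → 𝔽)
    (i : Fin n) (c : Column k d μ) :
    code k μ Ψ s i c = ∑ x, Ψ i x * modified s c.1.1 x c.1.2 := rfl

/-- A vector that is orthogonal to as many linearly independent vectors as there are coordinates is
zero. -/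
theorem eq_zero_of_linearIndependent {ι κ : Type*} [Fintype ι] [Fintype κ]
    (hcard : Fintype.card ι = Fintype.card κ) {a : ι → κ → 𝔽} (ha : LinearIndependent 𝔽 a)
    {v : κ → 𝔽} (hv : ∀ i, ∑ j, a i j * v j = 0) : v = 0 := by
  classical
  have hspan := ha.span_eq_top_of_card_eq_finrank' (by simpa using hcard)
  let φ : (κ → 𝔽) →ₗ[𝔽] 𝔽 := Fintype.linearCombination 𝔽 v
  have hφ : φ = 0 := by
    apply LinearMap.ext_on_range hspan
    intro i
    simpa [φ, Fintype.linearCombination_apply] using hv i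
  funext j
  have := LinearMap.congr_fun hφ (Pi.single j 1)
  simpa [φ, Fintype.linearCombination_apply, Pi.single_apply] using this

/-! ### Data recovery -/

/-- If the modified matrices vanish on the columns that have fewer than `u` elements in `[1:k]`,
then the symbols that a segment injects into the column `J ∩ [1:k]` of its children vanish. -/
theorem message_eq_zero_of_injected {s : FileSymbol k d μ → 𝔽} {u : ℕ}
    (ih : ∀ (Q : Segment d) (I : Finset (Fin d)), IsSegment k μ Q → I.card = mode μ Q →
      (I.filter (·.val < k)).card < u → ∀ x, modified s Q x I = 0)
    {P : Segment d} (hP : IsSegment k μ P) {x : Fin d} (hx : k ≤ x.val) {J : Finset (Fin d)}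
    (hJ : J.card = mode μ P) (hu : (J.filter (·.val < k)).card = u) (hu0 : 0 < u)
    (hxJ : ∃ j ∈ J, x ≤ j) : message s P x J = 0 := by
  set Y := J.filter (·.val < k) with hYdef
  set B := J.filter (¬ ·.val < k) with hBdef
  have hYB : Disjoint Y B := Finset.disjoint_filter_filter_not _ _ _
  have hJYB : Y ∪ B = J := Finset.filter_union_filter_not_eq _ _
  have hcard : Y.card + B.card = J.card := by rw [← hJYB, Finset.card_union_of_disjoint hYB]
  -- The child that protects this symbol; `0 < u` is what makes `|B|` smaller than the mode of `P`.
  have hQ : IsSegment k μ (.child P x B) := by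
    rw [isSegment_child]
    refine ⟨hP, ⟨hx, ?_, ?_⟩, by omega⟩
    · obtain ⟨j, hj, hxj⟩ := hxJ
      refine ⟨j, Finset.mem_filter.2 ⟨hj, ?_⟩, hxj⟩
      have : x.val ≤ j.val := hxj
      omega
    · intro j hj
      exact not_lt.1 (Finset.mem_filter.1 hj).2
  have hmode := mode_child hQ
  have hY : Y.Nonempty := Finset.card_pos.1 (by omega)
  have hsum := sum_modified_child s P x B hY
  rw [if_pos hYB, hJYB, Finset.sum_eq_zero] at hsum
  · exact neg_eq_zero.1 hsum.symm
  · intro y hy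
    have hc := Finset.card_erase_add_one hy
    rw [ih (.child P x B) (Y.erase y) hQ (by omega), mul_zero]
    exact (Finset.card_filter_le _ _).trans_lt (by omega)

theorem modified_eq_zero_of_low {s : FileSymbol k d μ → 𝔽} {P : Segment d}
    (hP : IsSegment k μ P) {x : Fin d} {J : Finset (Fin d)} (hx : k ≤ x.val)
    (hJ : ∀ j ∈ J, k ≤ j.val) : modified s P x J = 0 := by
  rw [modified, message_eq_zero_of_low s P hx hJ, zero_add]
  cases P with
  | root => rfl
  | child P z B =>
    have hn := (isSegment_child.1 hP).2.1
    rw [injection, message_eq_zero_of_low s P hn.1, mul_zero, ite_self]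
    intro j hj
    simp only [Finset.mem_union, Finset.mem_singleton] at hj
    rcases hj with (hj | rfl) | hj
    · exact hJ j hj
    · exact hx
    · exact hn.2.2 j hj

/-- Positions with `x ≤ max J` are injected into a child. A parity position reduces to these through
its parity equation, and its injected term is itself a protected symbol of the parent. -/
theorem modified_eq_zero_of_fewer {s : FileSymbol k d μ → 𝔽} {u : ℕ}
    (ih : ∀ (Q : Segment d) (I : Finset (Fin d)), IsSegment k μ Q → I.card = mode μ Q →
      (I.filter (·.val < k)).card < u → ∀ x, modified s Q x I = 0)
    {P : Segment d} (hP : IsSegment k μ P) {x : Fin d} (hx : k ≤ x.val) {J : Finset (Fin d)}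
    (hJ : J.card = mode μ P) (hu : (J.filter (·.val < k)).card = u) (hu0 : 0 < u) :
    modified s P x J = 0 := by
  by_cases hxJ : ∃ j ∈ J, x ≤ j
  · rw [modified_eq_message s P hxJ]
    exact message_eq_zero_of_injected ih hP hx hJ hu hu0 hxJ
  have hxnot : x ∉ J := fun h => hxJ ⟨x, h, le_rfl⟩
  have hmsg : message s P x J = 0 := by
    have hsum := sum_message_eq_zero s P (insert x J)
    rw [Finset.sum_insert hxnot, Finset.erase_insert hxnot, Finset.sum_eq_zero, add_zero] at hsum
    · exact neg_one_pow_mul_eq_zero hsum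
    intro y hy
    have hyx : y < x := lt_of_not_ge fun h => hxJ ⟨y, hy, h⟩
    have hxe : ∃ j ∈ (insert x J).erase y, y ≤ j :=
      ⟨x, Finset.mem_erase.2 ⟨hyx.ne', Finset.mem_insert_self x J⟩, hyx.le⟩
    have hcard : ((insert x J).erase y).card = mode μ P := by
      rw [Finset.card_erase_of_mem (Finset.mem_insert_of_mem hy),
        Finset.card_insert_of_notMem hxnot, hJ, Nat.add_sub_cancel]
    have hfil : ((insert x J).erase y).filter (·.val < k) = (J.filter (·.val < k)).erase y := by
      ext j
      simp only [Finset.mem_filter, Finset.mem_erase, Finset.mem_insert]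
      constructor
      · rintro ⟨⟨h1, rfl | h2⟩, h3⟩
        · omega
        · exact ⟨h1, h2, h3⟩
      · rintro ⟨h1, h2, h3⟩
        exact ⟨⟨h1, Or.inr h2⟩, h3⟩
    -- Removing an upper `y` lowers `u`; removing a lower one keeps `u`, but leaves row `y` below
    -- `x`, so the symbol is protected.
    rcases lt_or_ge y.val k with hyk | hyk
    · rw [← modified_eq_message s P hxe, ih P _ hP hcard, mul_zero]
      have := Finset.card_erase_lt_of_mem (Finset.mem_filter.2 ⟨hy, hyk⟩ :
        y ∈ J.filter (·.val < k))
      rw [hfil]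
      omega
    · rw [message_eq_zero_of_injected ih hP hyk hcard _ hu0 hxe, mul_zero]
      rw [hfil, Finset.erase_eq_of_notMem, hu]
      simp [hyk]
  rw [modified, hmsg, zero_add]
  cases P with
  | root => rfl
  | child P z B =>
    rw [injection]
    split_ifs with hc
    swap
    · rfl
    obtain ⟨-, hxB, hJB⟩ := hc
    have hn := (isSegment_child.1 hP)
    have hmode := mode_child hP
    have hd1 : Disjoint J {x} := Finset.disjoint_singleton_right.2 hxnot
    have hd2 : Disjoint (J ∪ {x}) B := by
      rw [Finset.disjoint_union_left, Finset.disjoint_singleton_left]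
      exact ⟨Finset.disjoint_iff_inter_eq_empty.2 hJB, hxB⟩
    -- The injected symbol sits in row `z ≤ max B` of the parent, in a column with the same upper
    -- part as `J`.
    rw [message_eq_zero_of_injected ih hn.1 hn.2.1.1 _ _ hu0, mul_zero]
    · obtain ⟨b, hb, hzb⟩ := hn.2.1.2.1
      exact ⟨b, Finset.mem_union_right _ hb, hzb⟩
    · rw [Finset.card_union_of_disjoint hd2, Finset.card_union_of_disjoint hd1,
        Finset.card_singleton]
      omega
    · rw [← hu]
      congr 1
      ext j
      simp only [Finset.mem_filter, Finset.mem_union, Finset.mem_singleton]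
      constructor
      · rintro ⟨(h1 | rfl) | h1, h2⟩
        · exact ⟨h1, h2⟩
        · omega
        · have := hn.2.1.2.2 j h1
          omega
      · rintro ⟨h1, h2⟩
        exact ⟨Or.inl (Or.inl h1), h2⟩

theorem modified_eq_zero_of_code {Ψ : Matrix (Fin n) (Fin d) 𝔽} (hΨ : IsEncoder k Ψ)
    (hkd : k ≤ d) {K : Finset (Fin n)} (hK : K.card = k) {s : FileSymbol k d μ → 𝔽}
    (hs : ∀ i ∈ K, code k μ Ψ s i = 0) {P : Segment d} {J : Finset (Fin d)}
    (hP : IsSegment k μ P) (hJ : J.card = mode μ P) (x : Fin d) : modified s P x J = 0 := by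
  induction hu : (J.filter (·.val < k)).card using Nat.strong_induction_on generalizing P J x with
  | _ u ih =>
  have ih' : ∀ (Q : Segment d) (I : Finset (Fin d)), IsSegment k μ Q → I.card = mode μ Q →
      (I.filter (·.val < k)).card < u → ∀ x, modified s Q x I = 0 :=
    fun Q I hQ hI hlt x => ih _ hlt hQ hI x rfl
  have hlow : ∀ x : Fin d, k ≤ x.val → modified s P x J = 0 := by
    intro x hx
    rcases Nat.eq_zero_or_pos u with h0 | h0
    · refine modified_eq_zero_of_low hP hx fun j hj => ?_
      rw [h0, Finset.card_eq_zero, Finset.filter_eq_empty_iff] at hu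
      exact not_lt.1 (hu hj)
    · exact modified_eq_zero_of_fewer ih' hP hx hJ hu h0
  -- With the lower rows gone, the codeword entries involve only `Γ`, whose rows in `K` form an
  -- invertible `k × k` matrix.
  have hup : (fun j : {j : Fin d // j.val < k} => modified s P j J) = 0 := by
    refine eq_zero_of_linearIndependent ?_ (hΨ.gamma K hK) ?_
    · rw [Fintype.card_coe, hK, Fintype.card_subtype]
      simp only [Fin.card_filter_val_lt]
      omega
    · intro i
      have h := congrFun (hs i i.2) ⟨(P, J), hP, hJ⟩
      rw [code_apply, Pi.zero_apply] at h
      rw [← h, ← Finset.sum_filter_of_ne (p := fun x : Fin d => x.val < k)]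
      · exact (Finset.sum_subtype _ (by simp) (fun x => Ψ i x * modified s P x J)).symm
      · intro x _ hne
        by_contra hx
        exact hne (by rw [hlow x (not_lt.1 hx), mul_zero])
  rcases lt_or_ge x.val k with hx | hx
  · exact congrFun hup ⟨x, hx⟩
  · exact hlow x hx

/-- The file is determined by the modified matrices. -/
theorem eq_zero_of_modified {s : FileSymbol k d μ → 𝔽}
    (h : ∀ (P : Segment d) (J : Finset (Fin d)), IsSegment k μ P → J.card = mode μ P →
      ∀ x, modified s P x J = 0) : s = 0 := by
  funext c
  rcases c with ⟨⟨P, x, X⟩, hc⟩ | ⟨⟨P, x, Y⟩, hc⟩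
  · obtain ⟨hP, hX, hx, -⟩ := id hc
    have h0 := h P X hP hX x
    rw [modified_eq_message s P ⟨x, hx, le_rfl⟩, message, if_pos hx] at h0
    have h1 := neg_one_pow_mul_eq_zero h0
    rwa [vSym, dif_pos hc] at h1
  · obtain ⟨hP, hY, hx, ⟨y, hy, hxy⟩, -⟩ := id hc
    have h0 := h P (Y.erase x) hP (by
      have := Finset.card_erase_add_one hx
      simp only at this hY
      omega) x
    rw [modified_eq_message s P ⟨y, Finset.mem_erase.2 ⟨hxy.ne', hy⟩, hxy.le⟩, message,
      if_neg (Finset.notMem_erase x Y), Finset.union_comm, ← Finset.insert_eq,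
      Finset.insert_erase hx] at h0
    have h1 := neg_one_pow_mul_eq_zero h0
    rwa [wSym, if_neg (fun hmax => (hmax y hy).not_gt hxy), wRaw, dif_pos hc] at h1

theorem exists_decode {Ψ : Matrix (Fin n) (Fin d) 𝔽} (hΨ : IsEncoder k Ψ) (hkd : k ≤ d)
    {K : Finset (Fin n)} (hK : K.card = k) :
    ∃ decode : (K → Column k d μ → 𝔽) → (FileSymbol k d μ → 𝔽),
      ∀ s, decode (fun i => code k μ Ψ s i) = s := by
  have hinj : Function.Injective
      (fun (s : FileSymbol k d μ → 𝔽) (i : K) => code k μ Ψ s i) := by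
    intro s t hst
    rw [← sub_eq_zero]
    refine eq_zero_of_modified fun P J hP hJ x =>
      modified_eq_zero_of_code hΨ hkd hK (fun i hi => ?_) hP hJ x
    rw [code_sub, sub_eq_zero]
    exact congrFun hst ⟨i, hi⟩
  exact hinj.hasLeftInverse

/-! ### Repair -/

theorem repairEncoder_insert (Ψ : Matrix (Fin n) (Fin d) 𝔽) (f : Fin n) (P : Segment d)
    {J : Finset (Fin d)} {y : Fin d} (hy : y ∉ J) :
    repairEncoder Ψ f P (insert y J) J =
      (-1) ^ (signature P y + ind (insert y J) y) * Ψ f y := by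
  have h : insert y J \ J = {y} := by
    rw [Finset.insert_sdiff_of_notMem _ hy, Finset.sdiff_self, insert_empty_eq]
  rw [repairEncoder, Finset.sum_eq_single y]
  · rw [if_pos h]
  · intro z _ hz
    rw [if_neg]
    rw [h, Finset.singleton_inj]
    exact hz.symm
  · simp

theorem repairEncoder_eq_zero (Ψ : Matrix (Fin n) (Fin d) 𝔽) (f : Fin n) (P : Segment d)
    {I J : Finset (Fin d)} (hcard : I.card = J.card + 1) (h : ∀ y ∉ J, I ≠ insert y J) :
    repairEncoder Ψ f P I J = 0 := by
  refine Finset.sum_eq_zero fun y _ => if_neg fun hy => ?_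
  have hyI : y ∈ I \ J := hy ▸ Finset.mem_singleton_self y
  have hyJ := (Finset.mem_sdiff.1 hyI).2
  refine h y hyJ (Finset.eq_of_subset_of_card_le ?_ ?_)
  · intro z hz
    by_cases hzJ : z ∈ J
    · exact Finset.mem_insert_of_mem hzJ
    · have : z ∈ I \ J := Finset.mem_sdiff.2 ⟨hz, hzJ⟩
      rw [hy, Finset.mem_singleton] at this
      exact this ▸ Finset.mem_insert_self _ _
  · rw [Finset.card_insert_of_notMem hyJ, hcard]

open Classical in
/-- The entry of a node content in the column `I` of the segment `P`; zero if there is no such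
column. -/
noncomputable def entry (c : Column k d μ → 𝔽) (P : Segment d) (I : Finset (Fin d)) : 𝔽 :=
  if h : IsSegment k μ P ∧ I.card = mode μ P then c ⟨(P, I), h⟩ else 0

theorem repairData_apply (Ψ : Matrix (Fin n) (Fin d) 𝔽) (f : Fin n) (c : Column k d μ → 𝔽)
    (r : RepairIndex k d μ) :
    repairData k μ Ψ f c r = ∑ y ∈ r.1.2ᶜ,
      (-1) ^ (signature r.1.1 y + ind (insert y r.1.2) y) * Ψ f y *
        entry c r.1.1 (insert y r.1.2) := by
  obtain ⟨⟨P, J⟩, hP, hJ⟩ := r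
  simp only at hP hJ ⊢
  have h1 : repairData k μ Ψ f c ⟨(P, J), hP, hJ⟩ =
      ∑ I : {I : Finset (Fin d) // I.card = mode μ P},
        entry c P I.1 * repairEncoder Ψ f P I.1 J := by
    change ∑ I : {I : Finset (Fin d) // I.card = mode μ P},
      c ⟨(P, I.1), hP, I.2⟩ * repairEncoder Ψ f P I.1 J = _
    refine Finset.sum_congr rfl fun I _ => ?_
    rw [entry, dif_pos ⟨hP, I.2⟩]
  rw [h1, ← Finset.sum_subtype (Finset.univ.filter fun I : Finset (Fin d) => I.card = mode μ P)
    (by simp) (fun I => entry c P I * repairEncoder Ψ f P I J)]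
  symm
  have hcard : ∀ y ∈ Jᶜ, (insert y J).card = mode μ P := fun y hy => by
    rw [Finset.card_insert_of_notMem (Finset.mem_compl.1 hy), hJ]
  refine Finset.sum_of_injOn (fun y => insert y J) ?_ ?_ ?_ ?_
  · intro y hy z hz hyz
    have hy' : y ∉ J := Finset.mem_compl.1 hy
    have : y ∈ insert z J := by
      simp only at hyz
      exact hyz ▸ Finset.mem_insert_self y J
    exact (Finset.mem_insert.1 this).resolve_right hy'
  · intro y hy
    simpa using hcard y hy
  · intro I hI hnot
    rw [repairEncoder_eq_zero, mul_zero]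
    · rw [(Finset.mem_filter.1 hI).2, hJ]
    · intro y hy hIy
      exact hnot ⟨y, by simpa using hy, hIy.symm⟩
  · intro y hy
    rw [repairEncoder_insert Ψ f P (Finset.mem_compl.1 hy)]
    ring

/-- The repair space of the failed node `f`: the entry in row `x` and column `J` of the product of
the modified matrix of `P` and its repair-encoder matrix. -/
noncomputable def repairSpace (Ψ : Matrix (Fin n) (Fin d) 𝔽) (f : Fin n)
    (s : FileSymbol k d μ → 𝔽) (P : Segment d) (x : Fin d) (J : Finset (Fin d)) : 𝔽 :=
  ∑ y ∈ Jᶜ, (-1) ^ (signature P y + ind (insert y J) y) * Ψ f y * modified s P x (insert y J)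

/-- Encoding acts on rows and the repair encoder on columns, so the two commute; `d` helpers can
thus invert their rows of `Ψ`. -/
theorem repairData_code (Ψ : Matrix (Fin n) (Fin d) 𝔽) (f h : Fin n)
    (s : FileSymbol k d μ → 𝔽) (r : RepairIndex k d μ) :
    repairData k μ Ψ f (code k μ Ψ s h) r =
      ∑ x, Ψ h x * repairSpace Ψ f s r.1.1 x r.1.2 := by
  rw [repairData_apply]
  simp only [repairSpace, Finset.mul_sum]
  rw [Finset.sum_comm]
  refine Finset.sum_congr rfl fun y hy => ?_
  rw [entry, dif_pos ⟨r.2.1, by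
    rw [Finset.card_insert_of_notMem (Finset.mem_compl.1 hy)]; exact r.2.2⟩, code_apply,
    Finset.mul_sum]
  exact Finset.sum_congr rfl fun x _ => by ring

/-- Expanding both double sums, the terms with `i ∈ I` and `y ∉ I` cancel by
`neg_one_pow_ind_erase`. The terms `y = i` of the first and `i = y` of the second are the two halves
of the left side. -/
theorem sum_repair_identity (σ : Fin d → ℕ) (ψ : Fin d → 𝔽) (D : Fin d → Finset (Fin d) → 𝔽)
    (I : Finset (Fin d)) :
    ∑ y, ψ y * D y I =
      ∑ i ∈ I, (-1) ^ (σ i + ind I i) * ∑ y ∈ (I.erase i)ᶜ,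
        (-1) ^ (σ y + ind (insert y (I.erase i)) y) * ψ y * D i (insert y (I.erase i)) +
      ∑ y ∈ Iᶜ, (-1) ^ (σ y + ind (insert y I) y) * ψ y *
        ∑ i ∈ insert y I, (-1) ^ (σ i + ind (insert y I) i) * D i ((insert y I).erase i) := by
  have h1 : ∀ i ∈ I, (-1) ^ (σ i + ind I i) * ∑ y ∈ (I.erase i)ᶜ,
        (-1) ^ (σ y + ind (insert y (I.erase i)) y) * ψ y * D i (insert y (I.erase i)) =
      ψ i * D i I - ∑ y ∈ Iᶜ, (-1) ^ (σ y + ind (insert y I) y) * ψ y *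
        ((-1) ^ (σ i + ind (insert y I) i) * D i ((insert y I).erase i)) := by
    intro i hi
    rw [Finset.compl_erase, Finset.sum_insert (by simpa using hi), Finset.insert_erase hi, mul_add,
      sub_eq_add_neg, Finset.mul_sum, ← Finset.sum_neg_distrib]
    congr 1
    · linear_combination ψ i * D i I * neg_one_pow_mul_self (𝔽 := 𝔽) (σ i + ind I i)
    · refine Finset.sum_congr rfl fun y hy => ?_
      have hy' : y ∉ I := Finset.mem_compl.1 hy
      have hiy : i ≠ y := fun h => hy' (h ▸ hi)
      rw [Finset.erase_insert_of_ne hiy.symm]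
      simp only [pow_add]
      linear_combination (-1) ^ σ i * (-1) ^ σ y * ψ y * D i (insert y (I.erase i)) *
        neg_one_pow_ind_erase (𝔽 := 𝔽) hi hy'
  have h2 : ∀ y ∈ Iᶜ, (-1) ^ (σ y + ind (insert y I) y) * ψ y *
        ∑ i ∈ insert y I, (-1) ^ (σ i + ind (insert y I) i) * D i ((insert y I).erase i) =
      ψ y * D y I + ∑ i ∈ I, (-1) ^ (σ y + ind (insert y I) y) * ψ y *
        ((-1) ^ (σ i + ind (insert y I) i) * D i ((insert y I).erase i)) := by
    intro y hy
    have hy' : y ∉ I := Finset.mem_compl.1 hy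
    rw [Finset.sum_insert hy', mul_add, Finset.erase_insert hy', Finset.mul_sum]
    congr 1
    linear_combination ψ y * D y I * neg_one_pow_mul_self (𝔽 := 𝔽) (σ y + ind (insert y I) y)
  rw [Finset.sum_congr rfl h1, Finset.sum_congr rfl h2, Finset.sum_sub_distrib,
    Finset.sum_add_distrib, Finset.sum_comm (s := I) (t := Iᶜ), ← Finset.sum_add_sum_compl I]
  ring

/-- The content of a failed node vanishes if its repair space does. -/
theorem sum_modified_eq_zero_of_repairSpace (Ψ : Matrix (Fin n) (Fin d) 𝔽) (f : Fin n)
    {s : FileSymbol k d μ → 𝔽}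
    (hR : ∀ (P : Segment d) (J : Finset (Fin d)), IsSegment k μ P → J.card + 1 = mode μ P →
      ∀ x, repairSpace Ψ f s P x J = 0)
    {Q : Segment d} {I : Finset (Fin d)} (hQ : IsSegment k μ Q) (hI : I.card = mode μ Q) :
    ∑ y, Ψ f y * modified s Q y I = 0 := by
  rw [sum_repair_identity (signature Q) (Ψ f) (modified s Q) I]
  have h1 : ∑ i ∈ I, (-1) ^ (signature Q i + ind I i) * ∑ y ∈ (I.erase i)ᶜ,
      (-1) ^ (signature Q y + ind (insert y (I.erase i)) y) * Ψ f y *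
        modified s Q i (insert y (I.erase i)) = 0 := by
    refine Finset.sum_eq_zero fun i hi => ?_
    have := hR Q (I.erase i) hQ (by rw [Finset.card_erase_add_one hi, hI]) i
    rw [repairSpace] at this
    rw [this, mul_zero]
  rw [h1, zero_add]
  cases Q with
  | root =>
    refine Finset.sum_eq_zero fun y _ => ?_
    rw [sum_modified_root, mul_zero]
  | child P x B =>
    simp only [sum_modified_child s P x B (Finset.insert_nonempty _ I)]
    by_cases hd : Disjoint I B
    swap
    · refine Finset.sum_eq_zero fun y _ => ?_
      rw [if_neg, mul_zero]
      exact fun h => hd (Finset.disjoint_insert_left.1 h).2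
    obtain ⟨hP, ⟨-, ⟨b, hb, hxb⟩, -⟩, -⟩ := isSegment_child.1 hQ
    have hmode := mode_child hQ
    -- The leftover parity sums should assemble into this entry; since `x ≤ max B`, injection leaves
    -- the parent untouched there.
    have h0 := hR P (I ∪ B) hP (by rw [Finset.card_union_of_disjoint hd]; omega) x
    rw [← neg_eq_zero, repairSpace, ← Finset.sum_neg_distrib] at h0
    refine Eq.trans (Eq.symm ?_) h0
    refine Finset.sum_subset_zero_on_sdiff ?_ ?_ ?_
    · exact Finset.compl_subset_compl.2 Finset.subset_union_left
    · intro y hy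
      simp only [Finset.mem_sdiff, Finset.mem_compl, Finset.mem_union, not_or, not_and,
        not_not] at hy
      rw [if_neg, mul_zero]
      exact fun h => (Finset.disjoint_insert_left.1 h).1 (hy.2 hy.1)
    · intro y hy
      simp only [Finset.mem_compl, Finset.mem_union, not_or] at hy
      have hd' : Disjoint (insert y I) B := Finset.disjoint_insert_left.2 ⟨hy.2, hd⟩
      rw [if_pos hd', modified_eq_message s P ⟨b, by simp [hb], hxb⟩, ← Finset.insert_union]
      have hsign : (-1 : 𝔽) ^ (signature (.child P x B) y + ind (insert y I) y) =
          (-1) ^ (signature P y + ind (insert y I ∪ B) y) := by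
        apply neg_one_pow_congr
        rw [signature, Finset.union_comm B, ← Finset.insert_eq, ind_insert_self hy.2, ind_union hd']
        exact ⟨1 + signature P y + ind B y + ind (insert y I) y, by ring⟩
      rw [hsign]
      ring

theorem exists_regenerate {Ψ : Matrix (Fin n) (Fin d) 𝔽} (hΨ : IsEncoder k Ψ) (f : Fin n)
    {H : Finset (Fin n)} (hH : H.card = d) :
    ∃ regenerate : (H → RepairIndex k d μ → 𝔽) → (Column k d μ → 𝔽),
      ∀ s, regenerate (fun h => repairData k μ Ψ f (code k μ Ψ s h)) = code k μ Ψ s f := by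
  have hfac : Function.FactorsThrough (fun s : FileSymbol k d μ → 𝔽 => code k μ Ψ s f)
      (fun (s : FileSymbol k d μ → 𝔽) (h : H) => repairData k μ Ψ f (code k μ Ψ s h)) := by
    intro s t hst
    simp only
    rw [← sub_eq_zero, ← code_sub]
    funext c
    rw [code_apply]
    refine sum_modified_eq_zero_of_repairSpace Ψ f (fun P J hP hJ x => ?_) c.2.1 c.2.2
    refine congrFun (eq_zero_of_linearIndependent (by simp [hH]) (hΨ.psi H hH)
      (v := fun x => repairSpace Ψ f (s - t) P x J) fun h => ?_) x
    rw [← repairData_code Ψ f h (s - t) ⟨(P, J), hP, hJ⟩, code_sub, map_sub]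
    exact congrFun (sub_eq_zero.2 (congrFun hst h)) _
  -- The value `0` is an arbitrary default for data that no file produces.
  exact ⟨_, fun s => hfac.extend_apply (fun _ => 0) s⟩

/-! ### Repair bandwidth -/

/-- The product of two consecutive repair-encoder matrices vanishes. -/
theorem sum_repair_repair (σ : Fin d → ℕ) (ψ : Fin d → 𝔽) (c : Finset (Fin d) → 𝔽)
    (L : Finset (Fin d)) :
    ∑ y ∈ Lᶜ, (-1) ^ (σ y + ind (insert y L) y) * ψ y * ∑ z ∈ (insert y L)ᶜ,
      (-1) ^ (σ z + ind (insert z (insert y L)) z) * ψ z * c (insert z (insert y L)) = 0 := by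
  simp only [Finset.mul_sum]
  rw [Finset.sum_sigma']
  refine Finset.sum_involution (fun p _ => ⟨p.2, p.1⟩) ?_ ?_ ?_ ?_
  · rintro ⟨y, z⟩ h
    simp only [Finset.mem_sigma, Finset.mem_compl, Finset.mem_insert, not_or] at h
    obtain ⟨hy, hzy, hz⟩ := h
    simp only [pow_add]
    rw [Finset.insert_comm y z L]
    have := neg_one_pow_ind_insert_comm (𝔽 := 𝔽) hy hz (Ne.symm hzy)
    rw [Finset.insert_comm z y L] at this ⊢
    linear_combination (-1) ^ σ y * (-1) ^ σ z * ψ y * ψ z * c (insert y (insert z L)) * this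
  · rintro ⟨y, z⟩ h _ heq
    simp only [Finset.mem_sigma, Finset.mem_compl, Finset.mem_insert, not_or] at h
    simp only [Sigma.mk.injEq] at heq
    exact h.2.1 heq.1
  · rintro ⟨y, z⟩ h
    simp only [Finset.mem_sigma, Finset.mem_compl, Finset.mem_insert, not_or] at h ⊢
    exact ⟨h.2.2, Ne.symm h.2.1, h.1⟩
  · rintro ⟨y, z⟩ _
    rfl

/-- The coordinates `(P, J)` with `y₀ ∉ J` determine the repair data for `f` if `Ψ f y₀ ≠ 0`. -/
theorem repairData_eq_zero (Ψ : Matrix (Fin n) (Fin d) 𝔽) {f : Fin n} {y₀ : Fin d}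
    (hy₀ : Ψ f y₀ ≠ 0) {c : Column k d μ → 𝔽}
    (hc : ∀ r : RepairIndex k d μ, y₀ ∉ r.1.2 → repairData k μ Ψ f c r = 0) :
    repairData k μ Ψ f c = 0 := by
  funext ⟨⟨P, J⟩, hP, hJ⟩
  by_cases hy : y₀ ∈ J
  swap
  · exact hc _ hy
  have hcard := Finset.card_erase_add_one hy
  have hsum := sum_repair_repair (signature P) (Ψ f) (entry c P) (J.erase y₀)
  simp only at hP hJ
  -- In the vanishing composition at `J \ {y₀}`, every `y ≠ y₀` leads to a column that avoids `y₀`,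
  -- where the repair data is zero.
  have hterm : ∀ y ∈ (J.erase y₀)ᶜ, (-1) ^ (signature P y + ind (insert y (J.erase y₀)) y) *
      Ψ f y * ∑ z ∈ (insert y (J.erase y₀))ᶜ,
        (-1) ^ (signature P z + ind (insert z (insert y (J.erase y₀))) z) * Ψ f z *
          entry c P (insert z (insert y (J.erase y₀))) =
      if y = y₀ then (-1) ^ (signature P y₀ + ind J y₀) * Ψ f y₀ *
        repairData k μ Ψ f c ⟨(P, J), hP, hJ⟩ else 0 := by
    intro y hyJ
    have hyJ' := Finset.mem_compl.1 hyJ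
    split_ifs with h
    · subst h
      rw [repairData_apply, Finset.insert_erase hy]
    · have := hc ⟨(P, insert y (J.erase y₀)), hP, by
        rw [Finset.card_insert_of_notMem hyJ']; simp only; omega⟩ (by simp [Ne.symm h])
      rw [repairData_apply] at this
      rw [this, mul_zero]
  rw [Finset.sum_congr rfl hterm, Finset.sum_ite_eq', if_pos (by simp), mul_assoc] at hsum
  exact (mul_eq_zero.1 (neg_one_pow_mul_eq_zero hsum)).resolve_left hy₀

/-- Supporting the content on columns containing `y₀` makes the system diagonal: a coordinate `J`
avoiding `y₀` then only sees the column `J ∪ {y₀}`. -/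
theorem exists_repairData_eq (Ψ : Matrix (Fin n) (Fin d) 𝔽) {f : Fin n} {y₀ : Fin d}
    (hy₀ : Ψ f y₀ ≠ 0) (g : RepairIndex k d μ → 𝔽) :
    ∃ c : Column k d μ → 𝔽, ∀ r : RepairIndex k d μ, y₀ ∉ r.1.2 →
      repairData k μ Ψ f c r = g r := by
  let c : Column k d μ → 𝔽 := fun q =>
    if h : y₀ ∈ q.1.2 then (-1) ^ (signature q.1.1 y₀ + ind q.1.2 y₀) * (Ψ f y₀)⁻¹ *
      g ⟨(q.1.1, q.1.2.erase y₀), q.2.1, by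
        rw [← q.2.2]; exact Finset.card_erase_add_one h⟩ else 0
  refine ⟨c, fun r hr => ?_⟩
  obtain ⟨⟨P, J⟩, hP, hJ⟩ := r
  simp only at hP hJ hr
  rw [repairData_apply, Finset.sum_eq_single_of_mem y₀ (by simpa using hr)]
  · have hcard : (insert y₀ J).card = mode μ P := by rw [Finset.card_insert_of_notMem hr, hJ]
    simp only
    rw [entry, dif_pos ⟨hP, hcard⟩]
    simp only [c]
    rw [dif_pos (Finset.mem_insert_self y₀ J)]
    simp only [Finset.erase_insert hr]
    have h1 := neg_one_pow_mul_self (𝔽 := 𝔽) (signature P y₀ + ind (insert y₀ J) y₀)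
    have h2 := mul_inv_cancel₀ hy₀
    set e := (-1 : 𝔽) ^ (signature P y₀ + ind (insert y₀ J) y₀)
    set t := g ⟨(P, J), hP, hJ⟩
    linear_combination e * e * t * h2 + t * h1
  · intro y hy hne
    have hyJ : y ∉ J := by simpa using hy
    simp only
    rw [entry, dif_pos ⟨hP, by rw [Finset.card_insert_of_notMem hyJ, hJ]⟩]
    simp only [c]
    rw [dif_neg, mul_zero]
    simp [hr, hne.symm]

theorem finrank_range_repairData (Ψ : Matrix (Fin n) (Fin d) 𝔽) {f : Fin n} {y₀ : Fin d}
    (hy₀ : Ψ f y₀ ≠ 0) [Finite {r : RepairIndex k d μ // y₀ ∉ r.1.2}] :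
    Module.finrank 𝔽 (LinearMap.range (repairData k μ Ψ f)) =
      Nat.card {r : RepairIndex k d μ // y₀ ∉ r.1.2} := by
  let π : (RepairIndex k d μ → 𝔽) →ₗ[𝔽] ({r : RepairIndex k d μ // y₀ ∉ r.1.2} → 𝔽) :=
    LinearMap.funLeft 𝔽 𝔽 Subtype.val
  have hbij : Function.Bijective (π.domRestrict (LinearMap.range (repairData k μ Ψ f))) := by
    constructor
    · rw [← LinearMap.ker_eq_bot, LinearMap.ker_eq_bot']
      rintro ⟨_, c, rfl⟩ hc
      exact Subtype.ext (repairData_eq_zero Ψ hy₀ fun r hr => congrFun hc ⟨r, hr⟩)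
    · intro g
      classical
      obtain ⟨c, hc⟩ := exists_repairData_eq Ψ hy₀
        (fun r => if h : y₀ ∉ r.1.2 then g ⟨r, h⟩ else 0)
      refine ⟨⟨_, c, rfl⟩, ?_⟩
      funext r
      refine (hc r.1 r.2).trans ?_
      rw [dif_pos r.2]
  rw [(LinearEquiv.ofBijective _ hbij).finrank_eq,
    Module.finrank_eq_nat_card_basis (Pi.basisFun 𝔽 _)]

theorem exists_ne_zero_of_isEncoder {Ψ : Matrix (Fin n) (Fin d) 𝔽} (hΨ : IsEncoder k Ψ)
    (hd : 0 < d) (hdn : d ≤ n) (f : Fin n) : ∃ y, Ψ f y ≠ 0 := by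
  obtain ⟨H, hfH, -, hH⟩ := Finset.exists_subsuperset_card_eq (n := d)
    (Finset.subset_univ {f}) (by rw [Finset.card_singleton]; exact hd) (by simpa using hdn)
  have := (hΨ.psi H hH).ne_zero ⟨f, hfH (Finset.mem_singleton_self f)⟩
  exact Function.ne_iff.1 this

/-! ### Generating functions -/

open PowerSeries in
theorem mk_choose (a : ℕ) : (mk fun j => (a.choose j : ℚ)) = (1 + X) ^ a := by
  have h : ((((1 + Polynomial.X) ^ a : Polynomial ℚ)) : PowerSeries ℚ) = (1 + X) ^ a := by simp
  ext j
  rw [← h, Polynomial.coeff_coe, Polynomial.coeff_one_add_X_pow, coeff_mk]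

-- By `card_nulled`, for `a = d - k` the coefficients in `mk` count the injection pairs by `|B|`.
open PowerSeries in
theorem X_mul_mk_choose_sub (a : ℕ) :
    X * (mk fun j => (a : ℚ) * a.choose j - a.choose (j + 1)) =
      1 - (1 + X) ^ a * (1 - C (a : ℚ) * X) := by
  rw [← mk_choose]
  ext j
  rcases j with _ | j
  · simp
  · rw [coeff_succ_X_mul, mul_sub, mul_one, ← mul_assoc, map_sub, map_sub, coeff_succ_mul_X,
      mul_comm _ (C _), coeff_C_mul, coeff_mk, coeff_mk, coeff_mk, coeff_one, if_neg (by omega)]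
    ring

/-- The generating function of the numbers of segments: the coefficient of `X ^ i` is the number of
segments whose mode is `i` less than that of the root, where `r = d - k`. -/
noncomputable def segmentSeries (r : ℕ) : PowerSeries ℚ :=
  ((1 + PowerSeries.X) ^ r * (1 - PowerSeries.C (r : ℚ) * PowerSeries.X))⁻¹

/-- The geometric series with ratio `r`. -/
noncomputable def geometricSeries (r : ℕ) : PowerSeries ℚ := PowerSeries.mk fun n => (r : ℚ) ^ n

open PowerSeries in
theorem segmentSeries_mul (r : ℕ) :
    segmentSeries r * ((1 + X) ^ r * (1 - C (r : ℚ) * X)) = 1 := by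
  rw [segmentSeries, PowerSeries.inv_mul_cancel]
  simp

open PowerSeries in
theorem geometricSeries_mul (r : ℕ) : geometricSeries r * (1 - C (r : ℚ) * X) = 1 := by
  ext j
  rcases j with _ | j
  · simp [geometricSeries]
  · rw [mul_sub, mul_one, ← mul_assoc, map_sub, coeff_succ_mul_X, mul_comm _ (C _), coeff_C_mul,
      geometricSeries, coeff_mk, coeff_mk, coeff_one, if_neg (by omega)]
    ring

open PowerSeries in
theorem segmentSeries_mul_one_add_X_pow (r j : ℕ) :
    segmentSeries r * (1 + X) ^ (r + j) = (1 + X) ^ j * geometricSeries r := by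
  rw [pow_add]
  linear_combination (1 + X) ^ j * geometricSeries r * segmentSeries_mul r -
    segmentSeries r * (1 + X) ^ r * (1 + X) ^ j * geometricSeries_mul r

-- From degree `j` on the product is purely geometric: each factor `1 + X` adds two consecutive
-- powers of `r`.
open PowerSeries in
theorem coeff_one_add_X_pow_mul_geometricSeries (r j m : ℕ) :
    coeff (j + m) ((1 + X) ^ j * geometricSeries r) = ((r : ℚ) + 1) ^ j * r ^ m := by
  induction j generalizing m with
  | zero => simp [geometricSeries]
  | succ j ih =>
    rw [pow_succ', mul_assoc, add_mul, one_mul, map_add, add_right_comm, coeff_succ_X_mul, ih,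
      add_assoc, ih]
    ring

open PowerSeries in
theorem coeff_one_one_add_X_pow_mul_geometricSeries (r j : ℕ) :
    coeff 1 ((1 + X) ^ j * geometricSeries r) = (r : ℚ) + j := by
  rw [← mk_choose, geometricSeries, coeff_mul]
  simp [Finset.Nat.antidiagonal_succ]

open PowerSeries in
theorem coeff_two_one_add_X_pow_mul_geometricSeries (r j : ℕ) :
    coeff 2 ((1 + X) ^ j * geometricSeries r) = (r : ℚ) ^ 2 + j * r + j * (j - 1) / 2 := by
  rw [← mk_choose, geometricSeries, coeff_mul]
  simp [Finset.Nat.antidiagonal_succ, Nat.cast_choose_two]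
  ring

/-! ### Counting -/

/-- The complementary pairs, with `p.1` above all of `p.2`, correspond to `(m + 1)`-sets by
splitting off the maximum. -/
theorem card_not_above_max (S : Finset (Fin d)) (m : ℕ) :
    ((S ×ˢ S.powersetCard m).filter fun p => ∃ j ∈ p.2, p.1 ≤ j).card + S.card.choose (m + 1) =
      S.card * S.card.choose m := by
  rw [← Finset.card_powersetCard m S, ← Finset.card_product,
    ← Finset.card_filter_add_card_filter_not (s := S ×ˢ S.powersetCard m)
      (fun p => ∃ j ∈ p.2, p.1 ≤ j), ← Finset.card_powersetCard (m + 1) S]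
  congr 1
  symm
  refine Finset.card_bij (fun p _ => insert p.1 p.2) ?_ ?_ ?_
  · rintro ⟨x, J⟩ h
    simp only [Finset.mem_filter, Finset.mem_product, Finset.mem_powersetCard, not_exists, not_and,
      not_le] at h ⊢
    obtain ⟨⟨hx, hJ, hc⟩, hlt⟩ := h
    exact ⟨Finset.insert_subset hx hJ,
      by rw [Finset.card_insert_of_notMem (fun hm => (hlt x hm).false), hc]⟩
  · rintro ⟨x, J⟩ h ⟨x', J'⟩ h' heq
    simp only [Finset.mem_filter, Finset.mem_product, Finset.mem_powersetCard, not_exists, not_and,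
      not_le] at h h' heq
    have hx : x ∉ J := fun hm => (h.2 x hm).false
    have hx' : x' ∉ J' := fun hm => (h'.2 x' hm).false
    have hxx : x = x' := by
      have h1 : x ∈ insert x' J' := heq ▸ Finset.mem_insert_self x J
      have h2 : x' ∈ insert x J := heq ▸ Finset.mem_insert_self x' J'
      rcases Finset.mem_insert.1 h1 with h1 | h1
      · exact h1
      rcases Finset.mem_insert.1 h2 with h2 | h2
      · exact h2.symm
      exact absurd (h.2 _ h2) (h'.2 _ h1).not_gt
    subst hxx
    rw [Prod.mk.injEq]
    refine ⟨rfl, ?_⟩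
    rw [← Finset.erase_insert hx, heq, Finset.erase_insert hx']
  · intro Y hY
    obtain ⟨hYS, hYc⟩ := Finset.mem_powersetCard.1 hY
    have hne : Y.Nonempty := Finset.card_pos.1 (by omega)
    have hmem := Y.max'_mem hne
    refine ⟨(Y.max' hne, Y.erase (Y.max' hne)), ?_, Finset.insert_erase hmem⟩
    simp only [Finset.mem_filter, Finset.mem_product, Finset.mem_powersetCard, not_exists, not_and,
      not_le]
    refine ⟨⟨hYS hmem, (Finset.erase_subset _ _).trans hYS, ?_⟩, fun j hj => ?_⟩
    · rw [Finset.card_erase_of_mem hmem, hYc, Nat.add_sub_cancel]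
    · exact lt_of_le_of_ne (Y.le_max' j (Finset.mem_of_mem_erase hj)) (Finset.ne_of_mem_erase hj)

/-- The positions `(x, J)` with `|J| = m` that are nulled; these are also the injection pairs
`(x, B)` with `|B| = m`. -/
def nulled (k d m : ℕ) : Finset (Fin d × Finset (Fin d)) :=
  ((Finset.univ.filter fun x : Fin d => k ≤ x.val) ×ˢ
    (Finset.univ.filter fun x : Fin d => k ≤ x.val).powersetCard m).filter
      fun p => ∃ j ∈ p.2, p.1 ≤ j

theorem mem_nulled {m : ℕ} {p : Fin d × Finset (Fin d)} :
    p ∈ nulled k d m ↔ p.2.card = m ∧ IsNulled k p.1 p.2 := by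
  simp only [nulled, Finset.mem_filter, Finset.mem_product, Finset.mem_powersetCard,
    Finset.mem_univ, true_and, Finset.subset_iff, IsNulled]
  tauto

theorem card_nulled (m : ℕ) : ((nulled k d m).card : ℚ) =
    ((d - k : ℕ) : ℚ) * (d - k).choose m - (d - k).choose (m + 1) := by
  have hlow : (Finset.univ.filter fun x : Fin d => k ≤ x.val).card = d - k := by
    have h := Finset.card_filter_add_card_filter_not (s := (Finset.univ : Finset (Fin d)))
      (fun x => x.val < k)
    simp only [not_lt, Fin.card_filter_val_lt, Finset.card_univ, Fintype.card_fin] at h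
    omega
  have h := card_not_above_max (Finset.univ.filter fun x : Fin d => k ≤ x.val) m
  rw [hlow] at h
  rw [eq_sub_iff_add_eq, nulled]
  exact_mod_cast h

theorem mode_le {P : Segment d} (hP : IsSegment k μ P) : mode μ P ≤ μ := by
  induction P with
  | root => exact le_rfl
  | child P x B ih =>
    have := mode_child hP
    have := ih (isSegment_child.1 hP).1
    omega

open PowerSeries in
theorem coeff_segmentSeries_succ (i : ℕ) : coeff (i + 1) (segmentSeries (d - k)) =
    ∑ b ∈ Finset.range (i + 1),
      ((nulled k d b).card : ℚ) * coeff (i - b) (segmentSeries (d - k)) := by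
  have h : segmentSeries (d - k) =
      1 + X * ((mk fun j => ((nulled k d j).card : ℚ)) * segmentSeries (d - k)) := by
    simp only [card_nulled]
    linear_combination segmentSeries_mul (d - k) -
      segmentSeries (d - k) * X_mul_mk_choose_sub (d - k)
  conv_lhs => rw [h]
  rw [map_add, coeff_succ_X_mul, coeff_one, if_neg (by omega), zero_add, coeff_mul,
    Finset.Nat.sum_antidiagonal_eq_sum_range_succ (fun a b => coeff a (mk fun j =>
      ((nulled k d j).card : ℚ)) * coeff b (segmentSeries (d - k)))]
  simp only [coeff_mk]

/-- A child for `(x, B)` lowers the mode by `|B| + 1`, which gives the recursion of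
`coeff_segmentSeries_succ`. The condition `|B| < mode P` is automatic as long as `i ≤ μ`. -/
theorem exists_segments {i : ℕ} (hi : i ≤ μ) : ∃ S : Finset (Segment d),
    (∀ P, P ∈ S ↔ IsSegment k μ P ∧ mode μ P + i = μ) ∧
      (S.card : ℚ) = PowerSeries.coeff i (segmentSeries (d - k)) := by
  classical
  induction i using Nat.strong_induction_on with
  | _ i ih =>
  rcases i with _ | i
  · refine ⟨{.root}, fun P => ?_, ?_⟩
    · rw [Finset.mem_singleton]
      constructor
      · rintro rfl
        exact ⟨trivial, rfl⟩
      · rintro ⟨hP, hm⟩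
        cases P with
        | root => rfl
        | child P x B =>
          have := mode_child hP
          have := mode_le (isSegment_child.1 hP).1
          omega
    · have := congrArg PowerSeries.constantCoeff (segmentSeries_mul (d - k))
      simpa using this.symm
  have ih' : ∀ b : ℕ, ∃ S : Finset (Segment d),
      b < i + 1 → (∀ P, P ∈ S ↔ IsSegment k μ P ∧ mode μ P + b = μ) ∧
        (S.card : ℚ) = PowerSeries.coeff b (segmentSeries (d - k)) := by
    intro b
    by_cases hb : b < i + 1
    · obtain ⟨S, hS⟩ := ih b hb (by omega)
      exact ⟨S, fun _ => hS⟩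
    · exact ⟨∅, fun h => absurd h hb⟩
  choose S hS using ih'
  let e : (Fin d × Finset (Fin d)) × Segment d ↪ Segment d :=
    ⟨fun p => .child p.2 p.1.1 p.1.2, by
      rintro ⟨⟨x, B⟩, P⟩ ⟨⟨x', B'⟩, P'⟩ h
      simp only [Segment.child.injEq] at h
      obtain ⟨rfl, rfl, rfl⟩ := h
      rfl⟩
  have he : ∀ (b : ℕ) (P : Segment d) (x : Fin d) (B : Finset (Fin d)),
      Segment.child P x B ∈ (nulled k d b ×ˢ S (i - b)).map e ↔
        (B.card = b ∧ IsNulled k x B) ∧ P ∈ S (i - b) := by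
    intro b P x B
    rw [← mem_nulled (p := (x, B)), ← Finset.mem_product (p := ((x, B), P))]
    exact Finset.mem_map' e (a := ((x, B), P))
  refine ⟨(Finset.range (i + 1)).biUnion fun b => (nulled k d b ×ˢ S (i - b)).map e, ?_, ?_⟩
  · intro P
    rw [Finset.mem_biUnion]
    constructor
    · rintro ⟨b, hb, hP⟩
      rw [Finset.mem_range] at hb
      obtain ⟨⟨⟨x, B⟩, P'⟩, -, rfl⟩ := Finset.mem_map.1 hP
      obtain ⟨⟨hB, hn⟩, hP'⟩ := (he b P' x B).1 hP
      obtain ⟨hseg, hmode⟩ := ((hS (i - b) (by omega)).1 P').1 hP'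
      have hchild : IsSegment k μ (.child P' x B) := isSegment_child.2 ⟨hseg, hn, by omega⟩
      refine ⟨hchild, ?_⟩
      have := mode_child hchild
      change mode μ (.child P' x B) + (i + 1) = μ
      omega
    · rintro ⟨hP, hm⟩
      cases P with
      | root => simp only [mode] at hm; omega
      | child P x B =>
        have hmode := mode_child hP
        obtain ⟨hseg, hn, -⟩ := isSegment_child.1 hP
        have := mode_le hseg
        have hb : B.card < i + 1 := by omega
        exact ⟨B.card, Finset.mem_range.2 hb, (he _ _ _ _).2 ⟨⟨rfl, hn⟩,
          ((hS (i - B.card) (by omega)).1 P).2 ⟨hseg, by omega⟩⟩⟩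
  · rw [Finset.card_biUnion]
    · rw [coeff_segmentSeries_succ]
      push_cast
      refine Finset.sum_congr rfl fun b _ => ?_
      rw [Finset.card_map, Finset.card_product, Nat.cast_mul, (hS (i - b) (by omega)).2]
    · intro b _ b' _ hbb
      rw [Function.onFun, Finset.disjoint_left]
      intro P hP hP'
      obtain ⟨⟨⟨x, B⟩, P'⟩, -, rfl⟩ := Finset.mem_map.1 hP
      exact hbb (((he b P' x B).1 hP).1.1.symm.trans ((he b' P' x B).1 hP').1.1)

open PowerSeries in
/-- The number of pairs of a segment and an element of `γ` that satisfies a condition depending on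
the mode of the segment. -/
theorem card_segment_prod {γ : Type*} [Fintype γ] (Q : ℕ → γ → Prop) :
    Finite {c : Segment d × γ // IsSegment k μ c.1 ∧ Q (mode μ c.1) c.2} ∧
      (Nat.card {c : Segment d × γ // IsSegment k μ c.1 ∧ Q (mode μ c.1) c.2} : ℚ) =
        coeff μ (segmentSeries (d - k) * mk fun j => (Nat.card {x // Q j x} : ℚ)) := by
  classical
  have h : ∀ i : ℕ, ∃ S : Finset (Segment d),
      i ≤ μ → (∀ P, P ∈ S ↔ IsSegment k μ P ∧ mode μ P + i = μ) ∧
        (S.card : ℚ) = coeff i (segmentSeries (d - k)) := by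
    intro i
    by_cases hi : i ≤ μ
    · obtain ⟨S, hS⟩ := exists_segments (k := k) (d := d) hi
      exact ⟨S, fun _ => hS⟩
    · exact ⟨∅, fun h => absurd h hi⟩
  choose S hS using h
  let T := (Finset.range (μ + 1)).biUnion fun i => S i ×ˢ Finset.univ.filter (Q (μ - i))
  have hT : ∀ c, c ∈ T ↔ IsSegment k μ c.1 ∧ Q (mode μ c.1) c.2 := by
    rintro ⟨P, x⟩
    simp only [T, Finset.mem_biUnion, Finset.mem_range, Finset.mem_product, Finset.mem_filter,
      Finset.mem_univ, true_and]
    constructor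
    · rintro ⟨i, hi, hP, hx⟩
      obtain ⟨hP, hm⟩ := ((hS i (by omega)).1 P).1 hP
      exact ⟨hP, by rwa [show mode μ P = μ - i by omega]⟩
    · rintro ⟨hP, hx⟩
      have := mode_le hP
      refine ⟨μ - mode μ P, by omega, ((hS _ (by omega)).1 P).2 ⟨hP, by omega⟩, ?_⟩
      rwa [Nat.sub_sub_self this]
  refine ⟨(T.finite_toSet.subset fun c hc => (hT c).2 hc).to_subtype, ?_⟩
  rw [Nat.subtype_card T hT, Finset.card_biUnion, coeff_mul,
    Finset.Nat.sum_antidiagonal_eq_sum_range_succ (fun a b => coeff a (segmentSeries (d - k)) *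
      coeff b (mk fun j => (Nat.card {x // Q j x} : ℚ)))]
  · push_cast
    refine Finset.sum_congr rfl fun i hi => ?_
    rw [Finset.card_product, Nat.cast_mul, (hS i (by simpa [Nat.lt_succ_iff] using hi)).2, coeff_mk,
      Nat.subtype_card (Finset.univ.filter (Q (μ - i))) (by simp)]
  · intro i hi j hj hij
    rw [Function.onFun, Finset.disjoint_left]
    rintro ⟨P, x⟩ hP hP'
    have h1 := ((hS i (by simpa [Nat.lt_succ_iff] using hi)).1 P).1 (Finset.mem_product.1 hP).1
    have h2 := ((hS j (by simpa [Nat.lt_succ_iff] using hj)).1 P).1 (Finset.mem_product.1 hP').1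
    exact hij (by omega)

open PowerSeries in
theorem card_column (hkd : k ≤ d) : Finite (Column k d μ) ∧
    (Nat.card (Column k d μ) : ℚ) = coeff μ ((1 + X) ^ k * geometricSeries (d - k)) := by
  obtain ⟨h1, h2⟩ := card_segment_prod (k := k) (μ := μ)
    (fun j (I : Finset (Fin d)) => I.card = j)
  refine ⟨h1, h2.trans ?_⟩
  rw [← segmentSeries_mul_one_add_X_pow, Nat.sub_add_cancel hkd, ← mk_choose]
  congr 3
  funext j
  rw [Nat.subtype_card (Finset.univ.powersetCard j) (by simp [Finset.mem_powersetCard]),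
    Finset.card_powersetCard, Finset.card_univ, Fintype.card_fin]

open PowerSeries in
theorem card_repairIndex (hk : 1 ≤ k) (hkd : k ≤ d) (hμ : 1 ≤ μ) (y₀ : Fin d) :
    Finite {r : RepairIndex k d μ // y₀ ∉ r.1.2} ∧
      (Nat.card {r : RepairIndex k d μ // y₀ ∉ r.1.2} : ℚ) =
        coeff (μ - 1) ((1 + X) ^ (k - 1) * geometricSeries (d - k)) := by
  obtain ⟨h1, h2⟩ := card_segment_prod (k := k) (μ := μ)
    (fun j (J : Finset (Fin d)) => J.card + 1 = j ∧ y₀ ∉ J)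
  let e : {r : RepairIndex k d μ // y₀ ∉ r.1.2} ≃ {c : Segment d × Finset (Fin d) //
      IsSegment k μ c.1 ∧ c.2.card + 1 = mode μ c.1 ∧ y₀ ∉ c.2} :=
    { toFun := fun r => ⟨r.1.1, r.1.2.1, r.1.2.2, r.2⟩
      invFun := fun c => ⟨⟨c.1, c.2.1, c.2.2.1⟩, c.2.2.2⟩
      left_inv := fun _ => rfl
      right_inv := fun _ => rfl }
  refine ⟨@Finite.of_equiv _ _ h1 e.symm, ?_⟩
  rw [Nat.card_congr e, h2]
  -- There are `(d - 1).choose (j - 1)` such sets; the factor `X` records the drop from mode `j` to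
  -- size `j - 1`.
  have hser : (mk fun j => (Nat.card {J : Finset (Fin d) // J.card + 1 = j ∧ y₀ ∉ J} : ℚ)) =
      X * (1 + X) ^ ((d - k) + (k - 1)) := by
    rw [show (d - k) + (k - 1) = d - 1 by omega, ← mk_choose]
    ext j
    rcases j with _ | j
    · simp
    · rw [coeff_succ_X_mul, coeff_mk, coeff_mk,
        Nat.subtype_card ((Finset.univ.erase y₀).powersetCard j), Finset.card_powersetCard,
        Finset.card_erase_of_mem (Finset.mem_univ _), Finset.card_univ, Fintype.card_fin]
      intro J
      rw [Finset.mem_powersetCard, Finset.subset_erase]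
      simp [and_comm]
  obtain ⟨μ, rfl⟩ := Nat.exists_eq_add_of_le' hμ
  rw [hser, mul_left_comm, segmentSeries_mul_one_add_X_pow, coeff_succ_X_mul, Nat.add_sub_cancel]

/-- The data symbols correspond to the positions `(x, J)` in the code segments that are neither
nulled nor parity positions. -/
def fileSymbolEquiv (k d μ : ℕ) : FileSymbol k d μ ≃
    {c : Segment d × (Fin d × Finset (Fin d)) // IsSegment k μ c.1 ∧
      c.2.2.card = mode μ c.1 ∧ (∃ j ∈ c.2.2, c.2.1 ≤ j) ∧ ¬ IsNulled k c.2.1 c.2.2} where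
  toFun
    | .inl p => ⟨p.1, p.2.1, p.2.2.1, ⟨p.1.2.1, p.2.2.2.1, le_rfl⟩, p.2.2.2.2⟩
    | .inr p => ⟨(p.1.1, p.1.2.1, p.1.2.2.erase p.1.2.1), p.2.1, by
        have h := Finset.card_erase_add_one p.2.2.2.1
        have h' := p.2.2.1
        simp only
        omega, by
        obtain ⟨y, hy, hxy⟩ := p.2.2.2.2.1
        exact ⟨y, Finset.mem_erase.2 ⟨hxy.ne', hy⟩, hxy.le⟩, p.2.2.2.2.2⟩
  invFun c :=
    if h : c.1.2.1 ∈ c.1.2.2 then .inl ⟨c.1, c.2.1, c.2.2.1, h, c.2.2.2.2⟩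
    else .inr ⟨(c.1.1, c.1.2.1, insert c.1.2.1 c.1.2.2), c.2.1, by
      simp only
      rw [Finset.card_insert_of_notMem h, c.2.2.1], Finset.mem_insert_self _ _, by
      obtain ⟨j, hj, hxj⟩ := c.2.2.2.1
      exact ⟨j, Finset.mem_insert_of_mem hj, lt_of_le_of_ne hxj fun he => h (he ▸ hj)⟩, by
      simp only
      rw [Finset.erase_insert h]
      exact c.2.2.2.2⟩
  left_inv c := by
    rcases c with ⟨⟨P, x, X⟩, hc⟩ | ⟨⟨P, x, Y⟩, hc⟩
    · simp only
      rw [dif_pos hc.2.2.1]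
    · simp only
      rw [dif_neg (Finset.notMem_erase x Y)]
      simp only [Finset.insert_erase hc.2.2.1]
  right_inv c := by
    rcases c with ⟨⟨P, x, J⟩, hc⟩
    by_cases h : x ∈ J
    · simp only [dif_pos h]
    · simp only [dif_neg h, Finset.erase_insert h]

open PowerSeries in
theorem card_fileSymbol (hkd : k ≤ d) : Finite (FileSymbol k d μ) ∧
    (Nat.card (FileSymbol k d μ) : ℚ) =
      d * coeff μ ((1 + X) ^ k * geometricSeries (d - k)) -
        coeff (μ + 1) ((1 + X) ^ k * geometricSeries (d - k)) := by
  obtain ⟨h1, h2⟩ := card_segment_prod (k := k) (μ := μ)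
    (fun j (p : Fin d × Finset (Fin d)) =>
      p.2.card = j ∧ (∃ j ∈ p.2, p.1 ≤ j) ∧ ¬ IsNulled k p.1 p.2)
  refine ⟨@Finite.of_equiv _ _ h1 (fileSymbolEquiv k d μ).symm, ?_⟩
  rw [Nat.card_congr (fileSymbolEquiv k d μ), h2]
  -- With threshold `0` the nulled positions are all non-parity positions, so the count is a
  -- difference of two instances of `card_nulled`.
  have hpos : ∀ j : ℕ, (Nat.card {p : Fin d × Finset (Fin d) //
      p.2.card = j ∧ (∃ j ∈ p.2, p.1 ≤ j) ∧ ¬ IsNulled k p.1 p.2} : ℚ) =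
      ((d : ℚ) * d.choose j - d.choose (j + 1)) -
        (((d - k : ℕ) : ℚ) * (d - k).choose j - (d - k).choose (j + 1)) := by
    intro j
    have hall : nulled k d j ⊆ nulled 0 d j := by
      intro p hp
      rw [mem_nulled] at hp ⊢
      exact ⟨hp.1, Nat.zero_le _, hp.2.2.1, fun _ _ => Nat.zero_le _⟩
    have h0 := card_nulled (k := 0) (d := d) j
    rw [Nat.sub_zero] at h0
    rw [Nat.subtype_card (nulled 0 d j \ nulled k d j), Finset.card_sdiff_of_subset hall,
      Nat.cast_sub (Finset.card_le_card hall), h0, card_nulled]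
    intro p
    have h : IsNulled 0 p.1 p.2 ↔ ∃ j ∈ p.2, p.1 ≤ j := by simp [IsNulled]
    rw [Finset.mem_sdiff, mem_nulled, mem_nulled, h]
    exact ⟨fun hp => ⟨hp.1.1, hp.1.2, fun hn => hp.2 ⟨hp.1.1, hn⟩⟩,
      fun hp => ⟨⟨hp.1, hp.2.1⟩, fun hn => hp.2.2 hn.2⟩⟩
  have hX : X * (segmentSeries (d - k) * mk fun j => ((d : ℚ) * d.choose j - d.choose (j + 1)) -
        (((d - k : ℕ) : ℚ) * (d - k).choose j - (d - k).choose (j + 1))) =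
      1 - (1 + X) ^ k * geometricSeries (d - k) * (1 - C (d : ℚ) * X) := by
    have hsub : (mk fun j => ((d : ℚ) * d.choose j - d.choose (j + 1)) -
        (((d - k : ℕ) : ℚ) * (d - k).choose j - (d - k).choose (j + 1))) =
        (mk fun j => (d : ℚ) * d.choose j - d.choose (j + 1)) -
          mk fun j => ((d - k : ℕ) : ℚ) * (d - k).choose j - (d - k).choose (j + 1) := by
      ext j
      simp
    have hA := segmentSeries_mul_one_add_X_pow (d - k) k
    rw [Nat.sub_add_cancel hkd] at hA
    rw [hsub]
    linear_combination segmentSeries (d - k) * X_mul_mk_choose_sub d -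
      segmentSeries (d - k) * X_mul_mk_choose_sub (d - k) + segmentSeries_mul (d - k) -
      (1 - C (d : ℚ) * X) * hA
  simp only [hpos]
  rw [← coeff_succ_X_mul, hX, map_sub, coeff_one, if_neg (by omega), mul_sub, mul_one, ← mul_assoc,
    map_sub, coeff_succ_mul_X, mul_comm _ (C _), coeff_C_mul]
  ring

/-! ### Assembling the regenerating code -/

theorem isRepairMechanism_code {β : ℕ} {Ψ : Matrix (Fin n) (Fin d) 𝔽} (hΨ : IsEncoder k Ψ)
    (hk : 1 ≤ k) (hkd : k ≤ d) (hdn : d < n) (hμ : 1 ≤ μ)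
    (hβ : (β : ℚ) = PowerSeries.coeff (μ - 1)
      ((1 + PowerSeries.X) ^ (k - 1) * geometricSeries (d - k))) :
    IsRepairMechanism d β (code k μ Ψ) (repairData k μ Ψ) := by
  intro f
  obtain ⟨y₀, hy₀⟩ := exists_ne_zero_of_isEncoder hΨ (by omega) hdn.le f
  obtain ⟨hfin, hcard⟩ := card_repairIndex hk hkd hμ y₀
  refine ⟨?_, fun H _ hH => exists_regenerate hΨ f hH⟩
  rw [finrank_range_repairData Ψ hy₀]
  rw [← hβ] at hcard
  exact_mod_cast hcard

/-- The symbols of a repair mechanism can be compressed to `β` symbols. -/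
theorem exists_repair_of_isRepairMechanism {σ ι ρ : Type*} [Finite ι] {d β : ℕ}
    {C : StorageCode 𝔽 σ ι n} {R : Fin n → (ι → 𝔽) →ₗ[𝔽] (ρ → 𝔽)}
    (hR : IsRepairMechanism d β C R) (f : Fin n) (H : Finset (Fin n)) (hf : f ∉ H)
    (hH : H.card = d) :
    ∃ (send : H → (ι → 𝔽) → (Fin β → 𝔽)) (regenerate : (H → Fin β → 𝔽) → (ι → 𝔽)),
      ∀ s, regenerate (fun h => send h (C s h)) = C s f := by
  obtain ⟨hrank, hreg⟩ := hR f
  obtain ⟨regenerate, hregen⟩ := hreg H hf hH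
  let e : LinearMap.range (R f) ≃ₗ[𝔽] (Fin β → 𝔽) :=
    LinearEquiv.ofFinrankEq _ _ (by rw [hrank, Module.finrank_fin_fun])
  refine ⟨fun _ c => e ⟨R f c, c, rfl⟩, fun g => regenerate fun h => e.symm (g h), fun s => ?_⟩
  simpa using hregen s

theorem isExactRepairRegeneratingCode_code {α β F : ℕ} {Ψ : Matrix (Fin n) (Fin d) 𝔽}
    (hΨ : IsEncoder k Ψ) (hkd : k ≤ d)
    (hR : IsRepairMechanism d β (code k μ Ψ) (repairData k μ Ψ))
    (hα : (α : ℚ) = PowerSeries.coeff μ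
      ((1 + PowerSeries.X) ^ k * geometricSeries (d - k)))
    (hF : (F : ℚ) = d * α - PowerSeries.coeff (μ + 1)
      ((1 + PowerSeries.X) ^ k * geometricSeries (d - k))) :
    IsExactRepairRegeneratingCode k d α β F (code k μ Ψ) := by
  obtain ⟨hfin, hcard⟩ := card_column (μ := μ) hkd
  obtain ⟨hfin', hcard'⟩ := card_fileSymbol (μ := μ) hkd
  rw [← hα] at hcard hcard'
  rw [← hF] at hcard'
  exact ⟨⟨hfin, by exact_mod_cast hcard⟩, ⟨hfin', by exact_mod_cast hcard'⟩,
    fun K hK => exists_decode hΨ hkd hK,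
    fun f H hf hH => exists_repair_of_isRepairMechanism hR f H hf hH⟩

end Cascade

/-! ### The extreme points of the cut-set bound -/

theorem two_mul_sum_Icc_sub_add_one (d : ℝ) (k : ℕ) :
    2 * ∑ i ∈ Finset.Icc 1 k, (d - i + 1) = k * (2 * d - k + 1) := by
  induction k with
  | zero => simp
  | succ k ih =>
    rw [Finset.sum_Icc_succ_top (by omega), mul_add, ih]
    push_cast
    ring

/-- Bounding each minimum by its second argument gives `F ≤ Fβ'`. At `β' = 1` all these bounds must
be tight, and the term `i = 1` forces `α' ≥ d`. -/
theorem isMBRPoint_of_two_mul_eq {k d : ℕ} (hk : 1 ≤ k) (hkd : k ≤ d) {F : ℝ}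
    (hF : 2 * F = k * (2 * (d : ℝ) - k + 1)) : IsMBRPoint k d d 1 F := by
  have hsum : ∑ i ∈ Finset.Icc 1 k, ((d : ℝ) - i + 1) = F := by
    linarith [two_mul_sum_Icc_sub_add_one (d : ℝ) k]
  have hpos : 0 < F := by
    have h1 : (1 : ℝ) ≤ k := by exact_mod_cast hk
    have h2 : (k : ℝ) ≤ d := by exact_mod_cast hkd
    have : 0 < (k : ℝ) * (2 * (d : ℝ) - k + 1) := mul_pos (by linarith) (by linarith)
    linarith
  have hmin : ∀ i ∈ Finset.Icc 1 k, min (d : ℝ) (((d : ℝ) - i + 1) * 1) = (d : ℝ) - i + 1 := by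
    intro i hi
    have : (1 : ℝ) ≤ i := by exact_mod_cast (Finset.mem_Icc.1 hi).1
    rw [mul_one, min_eq_right (by linarith)]
  refine ⟨?_, fun α β h => ⟨?_, ?_⟩⟩
  · rw [CutSetBound, Finset.sum_congr rfl hmin, hsum]
  · have h' : F ≤ F * β := by
      refine le_trans h ?_
      rw [← hsum, Finset.sum_mul]
      exact Finset.sum_le_sum fun i _ => min_le_right _ _
    exact (le_mul_iff_one_le_right hpos).1 h'
  · rintro rfl
    by_contra hlt
    rw [not_le] at hlt
    have h1 : (1 : ℕ) ∈ Finset.Icc 1 k := Finset.mem_Icc.2 ⟨le_rfl, hk⟩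
    refine absurd h (not_le.2 ?_)
    rw [← hsum]
    refine Finset.sum_lt_sum (fun i _ => ?_) ⟨1, h1, ?_⟩
    · exact (min_le_right _ _).trans (mul_one _).le
    · refine (min_le_left _ _).trans_lt ?_
      simpa using hlt

/-- Bounding each minimum by its first argument gives `F ≤ kα'`. When this is tight, the term `i =
k` forces `(d - k + 1)β' ≥ α`. -/
theorem isMSRPoint_of_mul_eq {k d : ℕ} (hk : 1 ≤ k) (hkd : k ≤ d) {α β F : ℝ} (hβ : 0 ≤ β)
    (hα : α = ((d : ℝ) - k + 1) * β) (hF : F = k * α) : IsMSRPoint k d α β F := by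
  have hk' : (1 : ℝ) ≤ k := by exact_mod_cast hk
  have hkd' : (k : ℝ) ≤ d := by exact_mod_cast hkd
  have hconst : ∑ _i ∈ Finset.Icc 1 k, α = F := by simp [hF]
  refine ⟨?_, fun α' β' h => ⟨?_, ?_⟩⟩
  · rw [CutSetBound, ← hconst]
    refine Finset.sum_le_sum fun i hi => le_min le_rfl ?_
    have : (i : ℝ) ≤ k := by exact_mod_cast (Finset.mem_Icc.1 hi).2
    rw [hα]
    exact mul_le_mul_of_nonneg_right (by linarith) hβ
  · have h' : k * α ≤ k * α' := by
      rw [← hF]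
      refine le_trans h ((Finset.sum_le_sum fun i _ => min_le_left _ _).trans ?_)
      simp
    exact le_of_mul_le_mul_left h' (by linarith)
  · rintro rfl
    by_contra hlt
    rw [not_le] at hlt
    have hmem : k ∈ Finset.Icc 1 k := Finset.mem_Icc.2 ⟨hk, le_rfl⟩
    refine absurd h (not_le.2 ?_)
    rw [← hconst]
    refine Finset.sum_lt_sum (fun i _ => min_le_left _ _) ⟨k, hmem, ?_⟩
    refine (min_le_right _ _).trans_lt ?_
    rw [hα]
    exact mul_lt_mul_of_pos_left hlt (by linarith)

theorem mainTheorem4 {𝔽 : Type*} [Field 𝔽] [Finite 𝔽] (n k d : ℕ)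
    (hk : 1 ≤ k) (hkd : k ≤ d) (hdn : d < n)
    (Ψ : Matrix (Fin n) (Fin d) 𝔽) (hΨ : Cascade.IsEncoder k Ψ) :
    (IsMBRCode k d d 1 (k * (2 * d - k + 1) / 2) (Cascade.code k 1 Ψ) ∧
      IsRepairMechanism d 1 (Cascade.code k 1 Ψ) (Cascade.repairData k 1 Ψ)) ∧
    (IsMSRCode k d ((d - k + 1) ^ k) ((d - k + 1) ^ (k - 1)) (k * (d - k + 1) ^ k)
        (Cascade.code k k Ψ) ∧
      IsRepairMechanism d ((d - k + 1) ^ (k - 1)) (Cascade.code k k Ψ)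
        (Cascade.repairData k k Ψ)) := by
  have hsub : ((d - k : ℕ) : ℚ) = (d : ℚ) - k := Nat.cast_sub hkd
  have hMBR : IsRepairMechanism d 1 (Cascade.code k 1 Ψ) (Cascade.repairData k 1 Ψ) := by
    refine Cascade.isRepairMechanism_code hΨ hk hkd hdn le_rfl ?_
    simp [Cascade.geometricSeries]
  have hMSR : IsRepairMechanism d ((d - k + 1) ^ (k - 1)) (Cascade.code k k Ψ)
      (Cascade.repairData k k Ψ) := by
    refine Cascade.isRepairMechanism_code hΨ hk hkd hdn hk ?_
    have h := Cascade.coeff_one_add_X_pow_mul_geometricSeries (d - k) (k - 1) 0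
    rw [Nat.add_zero] at h
    rw [h]
    simp
  have hF : 2 * (k * (2 * d - k + 1) / 2) = k * (2 * d - k + 1) := by
    refine Nat.mul_div_cancel' (even_iff_two_dvd.1 ?_)
    rw [Nat.even_mul]
    by_cases h : Even k
    · exact Or.inl h
    · refine Or.inr ?_
      rw [Nat.not_even_iff_odd] at h
      obtain ⟨j, rfl⟩ := h
      exact ⟨d - j, by omega⟩
  -- Moving `k * k` to the left removes the truncated subtraction, so that the identity can be cast.
  have hF' : 2 * (k * (2 * d - k + 1) / 2) + k * k = k * (2 * d + 1) := by
    rw [hF, ← mul_add]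
    congr 1
    omega
  refine ⟨⟨⟨?_, ?_⟩, hMBR⟩, ⟨⟨?_, ?_⟩, hMSR⟩⟩
  · refine Cascade.isExactRepairRegeneratingCode_code hΨ hkd hMBR ?_ ?_
    · rw [Cascade.coeff_one_one_add_X_pow_mul_geometricSeries, hsub]
      ring
    · rw [Cascade.coeff_two_one_add_X_pow_mul_geometricSeries, hsub]
      have h : 2 * ((k * (2 * d - k + 1) / 2 : ℕ) : ℚ) + k * k = k * (2 * d + 1) := by
        exact_mod_cast hF'
      linear_combination h / 2
  · rw [Nat.cast_one]
    have h : 2 * ((k * (2 * d - k + 1) / 2 : ℕ) : ℝ) + k * k = k * (2 * d + 1) := by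
      exact_mod_cast hF'
    exact isMBRPoint_of_two_mul_eq hk hkd (by linear_combination h)
  · refine Cascade.isExactRepairRegeneratingCode_code hΨ hkd hMSR ?_ ?_
    · have h := Cascade.coeff_one_add_X_pow_mul_geometricSeries (d - k) k 0
      rw [Nat.add_zero] at h
      rw [h]
      push_cast
      ring
    -- In degree `k + 1` the coefficient gains one factor `r = d - k`, so `F = (d - r)α = kα`.
    · rw [Cascade.coeff_one_add_X_pow_mul_geometricSeries]
      push_cast
      rw [hsub]
      ring
  · have hsubR : ((d - k : ℕ) : ℝ) = (d : ℝ) - k := Nat.cast_sub hkd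
    refine isMSRPoint_of_mul_eq hk hkd (Nat.cast_nonneg _) ?_ (by push_cast; ring)
    push_cast
    rw [hsubR, ← pow_succ', Nat.sub_add_cancel hk]
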